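/- Let $\mathbb{T}=\mathbb{R}/\mathbb{Z}$ and let $M(\mathbb{T})$ be the Banach algebra of complex Borel measures on $\mathbb{T}$ with convolution and the total variation norm. Regard $L^1(\mathbb{T})$ (with respect to normalized Haar measure, with convolution and the $L^1$ norm) as a subset of $M(\mathbb{T})$ via $f\mapsto f\,dx$. Put $$r(L^1(\mathbb{T}))=\{\mu\in M(\mathbb{T}):\ \mu^{*n}\in L^1(\mathbb{T})\text{ for some } n\ge 1\},$$ let $A$ be the norm closure of $r(L^1(\mathbb{T}))$ in $M(\mathbb{T})$, and let $B=L^1(\mathbb{T})$. For a commutative complex Banach algebra $R$ let $\triangle(R)$ be its Gelfand space, i.e. the set of nonzero multiplicative linear functionals with the weak$^*$ topology; $R$ is semisimple if for each $0\ne x\in R$ some $\varphi\in\triangle(R)$ has $\varphi(x)\neq0$, and radical if $\triangle(R)=\emptyset$. For distinct $\varphi_1,\dots,\varphi_n\in\triangle(R)$ the Nevanlinna–Pick norm on $\mathbb{C}^n$ is $$\|(a_1,\dots,a_n)\|_{NP(R;\varphi_1,\dots,\varphi_n)}=\inf\{\|x\|_R:\ x\in R,\ \varphi_i(x)=a_i\text{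 for } i=1,\dots,n\}.$$ Then $A$ (a closed subalgebra of $M(\mathbb{T})$) and $B$ are commutative semisimple Banach algebras, and the following hold. 1. $\triangle(A)=\triangle(B)=\mathbb{Z}$: the map sending $k\in\mathbb{Z}$ to the functional $\mu\mapsto\widehat{\mu}(k)=\int e^{-2\pi i kx}\,d\mu(x)$ is a homeomorphism from $\mathbb{Z}$ (discrete) onto $\triangle(A)$, and likewise $k\mapsto(f\mapsto\widehat f(k))$ is a homeomorphism from $\mathbb{Z}$ onto $\triangle(B)$. 2. With this identification all Nevanlinna–Pick norms of $A$ and $B$ coincide: for all distinct integers $k_1,\dots,k_n$ and all $(a_1,\dots,a_n)\in\mathbb{C}^n$, $$\|(a_1,\dots,a_n)\|_{NP(A;k_1,\dots,k_n)}=\|(a_1,\dots,a_n)\|_{NP(B;k_1,\dots,k_n)}.$$ 3. $A$ and $B$ are not isomorphic, not even as complex algebras without regard to topology. 4. $L^1(\mathbb{T})$ is a proper closed ideal of $A$ and the quotient $A/L^1(\mathbb{T})$ is radical, whereas for no proper closed ideal $I$ of $L^1(\mathbb{T})$ is $L^1(\mathbb{T})/I$ radical. -/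

import Mathlib

noncomputable section

open MeasureTheory Set
open scoped ENNReal

namespace CircleAlg

/-- Every complex measure has finite total variation. -/
instance finite_variation {X : Type*} [MeasurableSpace X] (μ : ComplexMeasure X) :
    IsFiniteMeasure μ.variation := by
  have hle : μ.variation ≤ (ComplexMeasure.re μ).variation + (ComplexMeasure.im μ).variation := by
    refine VectorMeasure.variation_le_of_forall_enorm_le fun E _ => ?_
    have h1 : ‖μ E‖ₑ ≤ ‖(μ E).re‖ₑ + ‖(μ E).im‖ₑ := by
      rw [← ofReal_norm, ← ofReal_norm, ← ofReal_norm,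
        ← ENNReal.ofReal_add (norm_nonneg _) (norm_nonneg _)]
      exact ENNReal.ofReal_le_ofReal (Complex.norm_le_abs_re_add_abs_im _)
    refine h1.trans (add_le_add ?_ ?_)
    · exact VectorMeasure.enorm_measure_le_variation (ComplexMeasure.re μ) E
    · exact VectorMeasure.enorm_measure_le_variation (ComplexMeasure.im μ) E
  rw [← SignedMeasure.totalVariation_eq_variation, ← SignedMeasure.totalVariation_eq_variation]
    at hle
  exact isFiniteMeasure_of_le _ hle

section Prod

variable {X Y Z : Type*} [MeasurableSpace X] [MeasurableSpace Y] [MeasurableSpace Z]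

/-- The product measure `μ × ν` of two complex measures. -/
def cprod (μ : ComplexMeasure X) (ν : ComplexMeasure Y) : ComplexMeasure (X × Y) :=
  μ.prod ν (ContinuousLinearMap.mul ℝ ℂ)

theorem cprod_apply (μ : ComplexMeasure X) (ν : ComplexMeasure Y) (s : Set X) (t : Set Y) :
    cprod μ ν (s ×ˢ t) = μ s * ν t := by
  simp [cprod]

theorem cprod_eq {μ : ComplexMeasure X} {ν : ComplexMeasure Y} {ρ : ComplexMeasure (X × Y)}
    (h : ∀ s t, MeasurableSet s → MeasurableSet t → ρ (s ×ˢ t) = μ s * ν t) :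
    cprod μ ν = ρ :=
  VectorMeasure.prod_eq_of_forall_apply_prod (by simpa using h)

theorem cprod_add (μ : ComplexMeasure X) (ν ν' : ComplexMeasure Y) :
    cprod μ (ν + ν') = cprod μ ν + cprod μ ν' :=
  cprod_eq fun s t _ _ => by simp [cprod_apply, mul_add]

theorem cprod_smul (c : ℂ) (μ : ComplexMeasure X) (ν : ComplexMeasure Y) :
    cprod (c • μ) ν = c • cprod μ ν :=
  cprod_eq fun s t _ _ => by simp [cprod_apply, mul_assoc]

theorem cprod_swap (μ : ComplexMeasure X) (ν : ComplexMeasure Y) :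
    (cprod μ ν).map Prod.swap = cprod ν μ := by
  refine (cprod_eq fun s t hs ht => ?_).symm
  rw [VectorMeasure.map_apply _ measurable_swap (hs.prod ht), preimage_swap_prod, cprod_apply,
    mul_comm]

theorem cprod_map_left {W : Type*} [MeasurableSpace W] (μ : ComplexMeasure X)
    (ν : ComplexMeasure Y) {f : X → W} (hf : Measurable f) :
    (cprod μ ν).map (Prod.map f id) = cprod (μ.map f) ν := by
  refine (cprod_eq fun s t hs ht => ?_).symm
  rw [VectorMeasure.map_apply _ (hf.prodMap measurable_id) (hs.prod ht),
    show Prod.map f id ⁻¹' s ×ˢ t = (f ⁻¹' s) ×ˢ t from rfl, cprod_apply, VectorMeasure.map_apply _ hf hs]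

theorem cprod_map_right {W : Type*} [MeasurableSpace W] (μ : ComplexMeasure X)
    (ν : ComplexMeasure Y) {f : Y → W} (hf : Measurable f) :
    (cprod μ ν).map (Prod.map id f) = cprod μ (ν.map f) := by
  refine (cprod_eq fun s t hs ht => ?_).symm
  rw [VectorMeasure.map_apply _ (measurable_id.prodMap hf) (hs.prod ht),
    show Prod.map id f ⁻¹' s ×ˢ t = s ×ˢ (f ⁻¹' t) from rfl, cprod_apply, VectorMeasure.map_apply _ hf ht]

theorem cprod_assoc (μ : ComplexMeasure X) (ν : ComplexMeasure Y) (ρ : ComplexMeasure Z) :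
    (cprod (cprod μ ν) ρ).map MeasurableEquiv.prodAssoc = cprod μ (cprod ν ρ) := by
  refine (cprod_eq fun s u hs hu => ?_).symm
  have hm : Measurable fun p : (X × Y) × Z => (p.1.2, p.2) := by fun_prop
  have hS : MeasurableSet {p : (X × Y) × Z | p.1.1 ∈ s} := by
    have : Measurable fun p : (X × Y) × Z => p.1.1 := by fun_prop
    exact this hs
  have key : cprod (μ s • ν) ρ =
      ((cprod (cprod μ ν) ρ).restrict {p | p.1.1 ∈ s}).map fun p => (p.1.2, p.2) := by
    refine cprod_eq fun t v ht hv => ?_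
    rw [VectorMeasure.map_apply _ hm (ht.prod hv),
      VectorMeasure.restrict_apply _ hS (hm (ht.prod hv))]
    have : ((fun p : (X × Y) × Z => (p.1.2, p.2)) ⁻¹' (t ×ˢ v)) ∩ {p | p.1.1 ∈ s} =
        (s ×ˢ t) ×ˢ v := by ext ⟨⟨x, y⟩, z⟩; simp; tauto
    rw [this, cprod_apply, cprod_apply]
    simp
  have h2 := congrArg (fun σ => σ u) key
  simp only [cprod_smul] at h2
  rw [VectorMeasure.map_apply _ hm hu, VectorMeasure.restrict_apply _ hS (hm hu)] at h2
  rw [VectorMeasure.map_apply _ MeasurableEquiv.prodAssoc.measurable (hs.prod hu)]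
  have h3 : (MeasurableEquiv.prodAssoc : (X × Y) × Z ≃ᵐ X × Y × Z) ⁻¹' (s ×ˢ u) =
      ((fun p : (X × Y) × Z => (p.1.2, p.2)) ⁻¹' u) ∩ {p | p.1.1 ∈ s} := by
    ext ⟨⟨x, y⟩, z⟩; simp [MeasurableEquiv.prodAssoc]; tauto
  rw [h3, ← h2]
  simp

end Prod

/-- `M(𝕋)`: the complex Borel measures on the circle `𝕋 = ℝ / ℤ`. -/
def MT : Type := ComplexMeasure UnitAddCircle

namespace MT

instance : AddCommGroup MT := inferInstanceAs (AddCommGroup (ComplexMeasure UnitAddCircle))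
instance : Module ℂ MT := inferInstanceAs (Module ℂ (ComplexMeasure UnitAddCircle))

/-- The underlying complex measure. -/
def val (μ : MT) : ComplexMeasure UnitAddCircle := μ

/-- Convolution: the image of the product measure under addition. -/
def conv (μ ν : MT) : MT := (cprod μ.val ν.val).map fun p => p.1 + p.2

theorem add_measurable : Measurable fun p : UnitAddCircle × UnitAddCircle => p.1 + p.2 := by
  fun_prop

theorem map_map {X Y Z : Type*} [MeasurableSpace X] [MeasurableSpace Y] [MeasurableSpace Z]
    (μ : ComplexMeasure X) {f : X → Y} {g : Y → Z} (hf : Measurable f) (hg : Measurable g) :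
    (μ.map f).map g = μ.map (g ∘ f) := by
  ext s hs
  rw [VectorMeasure.map_apply _ hg hs, VectorMeasure.map_apply _ hf (hg hs),
    VectorMeasure.map_apply _ (hg.comp hf) hs, preimage_comp]

theorem conv_comm (μ ν : MT) : conv μ ν = conv ν μ := by
  unfold conv
  rw [← cprod_swap, map_map _ measurable_swap add_measurable]
  congr 1
  ext p
  simp [add_comm]

theorem conv_add (μ ν ρ : MT) : conv μ (ν + ρ) = conv μ ν + conv μ ρ := by
  unfold conv
  exact (congrArg (fun σ => VectorMeasure.map σ fun p => p.1 + p.2)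
    (cprod_add μ.val ν.val ρ.val)).trans (VectorMeasure.map_add _ _ _)

theorem smul_conv (c : ℂ) (μ ν : MT) : conv (c • μ) ν = c • conv μ ν := by
  unfold conv
  exact (congrArg (fun σ => VectorMeasure.map σ fun p => p.1 + p.2)
    (cprod_smul c μ.val ν.val)).trans (VectorMeasure.map_smul _)

theorem conv_assoc (μ ν ρ : MT) : conv (conv μ ν) ρ = conv μ (conv ν ρ) := by
  change (cprod ((cprod μ.val ν.val).map _) ρ.val).map _ =
    (cprod μ.val ((cprod ν.val ρ.val).map _)).map _
  rw [← cprod_map_left _ _ add_measurable, ← cprod_map_right _ _ add_measurable, ← cprod_assoc,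
    map_map _ (add_measurable.prodMap measurable_id) add_measurable,
    map_map _ (measurable_id.prodMap add_measurable) add_measurable,
    map_map _ (MeasurableEquiv.measurable _)
      (add_measurable.comp (measurable_id.prodMap add_measurable))]
  congr 1
  ext p
  simp [MeasurableEquiv.prodAssoc, add_assoc]

/-- The unit mass at `0`. -/
def delta : MT := VectorMeasure.dirac (0 : UnitAddCircle) (1 : ℂ)

theorem delta_conv (μ : MT) : conv delta μ = μ := by
  have h : cprod delta.val μ.val = μ.val.map (Prod.mk (0 : UnitAddCircle)) := by
    refine cprod_eq fun s t hs ht => ?_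
    rw [VectorMeasure.map_apply _ measurable_prodMk_left (hs.prod ht)]
    by_cases h0 : (0 : UnitAddCircle) ∈ s
    · simp [delta, val, hs, h0]
    · simpa [delta, val, hs, h0] using μ.val.empty
  unfold conv
  rw [h, map_map _ measurable_prodMk_left add_measurable]
  have : ((fun p : UnitAddCircle × UnitAddCircle => p.1 + p.2) ∘ Prod.mk 0) = id := by
    ext x; simp
  rw [this]
  exact VectorMeasure.map_id _

/-- `M(𝕋)` as a commutative ring under convolution. -/
instance : CommRing MT :=
  { (inferInstance : AddCommGroup MT) with
    mul := conv
    one := delta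
    mul_comm := conv_comm
    mul_assoc := conv_assoc
    left_distrib := conv_add
    right_distrib := fun a b c => by
      change conv (a + b) c = conv a c + conv b c
      rw [conv_comm, conv_add, conv_comm c, conv_comm c]
    zero_mul := fun a => by
      change conv 0 a = 0
      simpa using smul_conv 0 0 a
    mul_zero := fun a => by
      change conv a 0 = 0
      rw [conv_comm]
      simpa using smul_conv 0 0 a
    one_mul := delta_conv
    mul_one := fun a => (conv_comm a delta).trans (delta_conv a) }

theorem mul_def (μ ν : MT) : μ * ν = conv μ ν := rfl

instance : Algebra ℂ MT :=
  Algebra.ofModule (fun c μ ν => smul_conv c μ ν) fun c μ ν => by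
    rw [mul_comm, mul_comm μ ν]; exact smul_conv c ν μ

/-- The total variation norm. -/
instance : Norm MT := ⟨fun μ => (μ.val.variation univ).toReal⟩

theorem norm_def (μ : MT) : ‖μ‖ = (μ.val.variation univ).toReal := rfl

theorem norm_add_le' (μ ν : MT) : ‖μ + ν‖ ≤ ‖μ‖ + ‖ν‖ := by
  have h : (μ + ν).val.variation univ ≤ μ.val.variation univ + ν.val.variation univ :=
    VectorMeasure.variation_add_le (μ := μ.val) (ν := ν.val) univ
  rw [norm_def, norm_def, norm_def, ← ENNReal.toReal_add (measure_ne_top _ _) (measure_ne_top _ _)]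
  exact ENNReal.toReal_mono (by finiteness) h

theorem norm_smul' (c : ℂ) (μ : MT) : ‖c • μ‖ = ‖c‖ * ‖μ‖ := by
  have h : (c • μ).val.variation = ‖c‖₊ • μ.val.variation := VectorMeasure.variation_smul
  rw [norm_def, norm_def, h]
  simp

theorem norm_conv_le (μ ν : MT) : ‖μ * ν‖ ≤ ‖μ‖ * ‖ν‖ := by
  have h1 : (μ * ν).val.variation univ ≤ (cprod μ.val ν.val).variation univ := by
    have := VectorMeasure.variation_map_le (μ := cprod μ.val ν.val)
      (φ := fun p : UnitAddCircle × UnitAddCircle => p.1 + p.2) univ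
    rwa [Measure.map_apply add_measurable MeasurableSet.univ, preimage_univ] at this
  have h2 : (cprod μ.val ν.val).variation univ ≤ μ.val.variation univ * ν.val.variation univ := by
    have := VectorMeasure.variation_prod_le (μ := μ.val) (ν := ν.val)
      (B := ContinuousLinearMap.mul ℝ ℂ) univ
    refine this.trans ?_
    rw [Measure.smul_apply, ← univ_prod_univ, Measure.prod_prod, smul_eq_mul]
    refine mul_le_of_le_one_left' ?_
    rw [← ofReal_norm, ContinuousLinearMap.opNorm_mul, ENNReal.ofReal_one]
  rw [norm_def, norm_def, norm_def, ← ENNReal.toReal_mul]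
  exact ENNReal.toReal_mono (by finiteness) (h1.trans h2)

instance : NormedAddCommGroup MT :=
  AddGroupNorm.toNormedAddCommGroup
    { toFun := fun μ => ‖μ‖
      map_zero' := by simpa using norm_smul' 0 0
      add_le' := norm_add_le'
      neg' := fun μ => by simpa using norm_smul' (-1) μ
      eq_zero_of_map_eq_zero' := fun μ h => by
        have h0 : μ.val.variation univ = 0 := by
          rcases (ENNReal.toReal_eq_zero_iff _).1 h with h | h
          · exact h
          · exact absurd h (measure_ne_top _ _)
        exact VectorMeasure.variation_eq_zero.1 (Measure.measure_univ_eq_zero.1 h0) }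

/-- `M(𝕋)` with convolution and the total variation norm. -/
instance : NormedCommRing MT :=
  { (inferInstance : NormedAddCommGroup MT), (inferInstance : CommRing MT) with
    norm_mul_le := norm_conv_le }

instance : NormedAlgebra ℂ MT :=
  { (inferInstance : Algebra ℂ MT) with norm_smul_le := fun c μ => (norm_smul' c μ).le }


/-- The Fourier–Stieltjes coefficient `∫ e^{-2πikx} dμ(x)`. -/
def coeff (μ : MT) (k : ℤ) : ℂ :=
  μ.val.integral (fun x => fourier (-k) x) (ContinuousLinearMap.mul ℝ ℂ)

end MT

open AddCircle (haarAddCircle)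

/-- `L¹(𝕋)` with respect to the normalized Haar measure. -/
def L1T : Type := Lp ℂ 1 (haarAddCircle (T := 1))

namespace L1T

instance : NormedAddCommGroup L1T :=
  inferInstanceAs (NormedAddCommGroup (Lp ℂ 1 (haarAddCircle (T := 1))))
instance : NormedSpace ℂ L1T :=
  inferInstanceAs (NormedSpace ℂ (Lp ℂ 1 (haarAddCircle (T := 1))))
instance : CompleteSpace L1T :=
  inferInstanceAs (CompleteSpace (Lp ℂ 1 (haarAddCircle (T := 1))))

/-- The underlying element of Mathlib's `L¹` space. -/
def val (f : L1T) : Lp ℂ 1 (haarAddCircle (T := 1)) := f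

/-- A function on the circle representing the class `f`. -/
def fn (f : L1T) : UnitAddCircle → ℂ := f.val

theorem integrable_fn (f : L1T) : Integrable f.fn (haarAddCircle (T := 1)) :=
  L1.integrable_coeFn f.val

/-- The class of an integrable function. -/
def mk (g : UnitAddCircle → ℂ) (hg : Integrable g (haarAddCircle (T := 1))) : L1T := hg.toL1 g

theorem fn_mk (g : UnitAddCircle → ℂ) (hg : Integrable g (haarAddCircle (T := 1))) :
    (mk g hg).fn =ᵐ[haarAddCircle] g :=
  hg.coeFn_toL1

theorem convolution_integrable (f g : L1T) :
    Integrable (convolution f.fn g.fn (ContinuousLinearMap.mul ℂ ℂ) (haarAddCircle (T := 1)))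
      (haarAddCircle (T := 1)) :=
  f.integrable_fn.integrable_convolution _ g.integrable_fn

/-- The product of `L¹(𝕋)` is convolution, `(f * g)(x) = ∫ f(t) g(x - t) dt`. -/
instance : Mul L1T := ⟨fun f g => mk _ (convolution_integrable f g)⟩

theorem fn_mul (f g : L1T) : (f * g).fn =ᵐ[haarAddCircle]
    convolution f.fn g.fn (ContinuousLinearMap.mul ℂ ℂ) (haarAddCircle (T := 1)) :=
  fn_mk _ (convolution_integrable f g)

/-- The measure `f dx`: the inclusion of `L¹(𝕋)` into `M(𝕋)`. -/
def toMT (f : L1T) : MT := (haarAddCircle (T := 1)).withDensityᵥ f.fn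

theorem toMT_apply (f : L1T) {s : Set UnitAddCircle} (hs : MeasurableSet s) :
    f.toMT.val s = ∫ x in s, f.fn x ∂(haarAddCircle (T := 1)) :=
  withDensityᵥ_apply f.integrable_fn hs

theorem toMT_mk (g : UnitAddCircle → ℂ) (hg : Integrable g (haarAddCircle (T := 1))) :
    (mk g hg).toMT = (haarAddCircle (T := 1)).withDensityᵥ g :=
  (Integrable.withDensityᵥ_eq_iff (mk g hg).integrable_fn hg).2 (fn_mk g hg)

theorem toMT_injective : Function.Injective toMT := fun f g h =>
  Lp.ext ((Integrable.withDensityᵥ_eq_iff f.integrable_fn g.integrable_fn).1 h)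

theorem toMT_add (f g : L1T) : (f + g).toMT = f.toMT + g.toMT := by
  have h : (haarAddCircle (T := 1)).withDensityᵥ (f + g).fn =
      (haarAddCircle (T := 1)).withDensityᵥ (f.fn + g.fn) :=
    (Integrable.withDensityᵥ_eq_iff (f + g).integrable_fn
      (f.integrable_fn.add g.integrable_fn)).2 (Lp.coeFn_add f.val g.val)
  exact h.trans (withDensityᵥ_add f.integrable_fn g.integrable_fn)

theorem toMT_smul (c : ℂ) (f : L1T) : (c • f).toMT = c • f.toMT := by
  have h : (haarAddCircle (T := 1)).withDensityᵥ (c • f).fn =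
      (haarAddCircle (T := 1)).withDensityᵥ (c • f.fn) :=
    (Integrable.withDensityᵥ_eq_iff (c • f).integrable_fn
      (f.integrable_fn.smul c)).2 (Lp.coeFn_smul c f.val)
  exact h.trans (withDensityᵥ_smul _ _)

theorem norm_toMT (f : L1T) : ‖f.toMT‖ = ‖f‖ := by
  have h1 : f.toMT.val.variation =
      (haarAddCircle (T := 1)).withDensity (fun x => ‖f.fn x‖ₑ) :=
    Measure.variation_withDensityᵥ f.integrable_fn
  rw [MT.norm_def, h1, withDensity_apply _ MeasurableSet.univ, Measure.restrict_univ]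
  have h2 : ‖f‖ = (eLpNorm f.fn 1 (haarAddCircle (T := 1))).toReal := rfl
  rw [h2, eLpNorm_one_eq_lintegral_enorm]

theorem toMT_mul (f g : L1T) : (f * g).toMT = f.toMT * g.toMT := by
  have hint : Integrable (fun p : UnitAddCircle × UnitAddCircle => f.fn p.1 * g.fn p.2)
      ((haarAddCircle (T := 1)).prod (haarAddCircle (T := 1))) :=
    f.integrable_fn.mul_prod g.integrable_fn
  have hprod : cprod f.toMT.val g.toMT.val =
      ((haarAddCircle (T := 1)).prod (haarAddCircle (T := 1))).withDensityᵥ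
        (fun p => f.fn p.1 * g.fn p.2) := by
    refine cprod_eq fun s t hs ht => ?_
    rw [withDensityᵥ_apply hint (hs.prod ht), setIntegral_prod_mul, toMT_apply _ hs,
      toMT_apply _ ht]
  refine (toMT_mk _ (convolution_integrable f g)).trans ?_
  change _ = (cprod f.toMT.val g.toMT.val).map _
  rw [hprod]
  ext s hs
  rw [withDensityᵥ_apply (convolution_integrable f g) hs,
    VectorMeasure.map_apply _ MT.add_measurable hs,
    withDensityᵥ_apply hint (MT.add_measurable hs),
    ← integral_indicator hs, ← integral_indicator (MT.add_measurable hs)]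
  have hc := f.integrable_fn.convolution_integrand (ContinuousLinearMap.mul ℂ ℂ) g.integrable_fn
  have hc' : Integrable (fun p : UnitAddCircle × UnitAddCircle =>
      s.indicator (fun _ => (1 : ℂ)) p.1 * (f.fn p.2 * g.fn (p.1 - p.2)))
      ((haarAddCircle (T := 1)).prod (haarAddCircle (T := 1))) := by
    refine (hc.indicator (measurable_fst hs)).congr (Filter.Eventually.of_forall fun p => ?_)
    by_cases hp : p.1 ∈ s <;> simp [indicator, hp]
  have hshear := measurePreserving_add_prod (haarAddCircle (T := 1)) (haarAddCircle (T := 1))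
  have e1 : ∀ x, s.indicator (convolution f.fn g.fn (ContinuousLinearMap.mul ℂ ℂ)
      (haarAddCircle (T := 1))) x = ∫ t, s.indicator (fun _ => (1 : ℂ)) x *
        (f.fn t * g.fn (x - t)) ∂(haarAddCircle (T := 1)) := fun x => by
    by_cases hx : x ∈ s <;> simp [indicator, hx, convolution]
  simp_rw [e1]
  rw [← integral_prod (f := fun p : UnitAddCircle × UnitAddCircle =>
      s.indicator (fun _ => (1 : ℂ)) p.1 * (f.fn p.2 * g.fn (p.1 - p.2))) hc']
  have hmap := integral_map (μ := (haarAddCircle (T := 1)).prod (haarAddCircle (T := 1)))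
    (φ := fun z : UnitAddCircle × UnitAddCircle => (z.1 + z.2, z.2))
    hshear.measurable.aemeasurable (f := fun p : UnitAddCircle × UnitAddCircle =>
      s.indicator (fun _ => (1 : ℂ)) p.1 * (f.fn p.2 * g.fn (p.1 - p.2)))
    (by rw [hshear.map_eq]; exact hc'.aestronglyMeasurable)
  rw [hshear.map_eq] at hmap
  rw [hmap, ← integral_prod_swap]
  refine integral_congr_ae (Filter.Eventually.of_forall fun p => ?_)
  by_cases hp : p.1 + p.2 ∈ s
  · simp [indicator, hp, add_comm p.2]
  · simp [indicator, hp, add_comm p.2]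

/-- `L¹(𝕋)` as a commutative ring under convolution. -/
instance : NonUnitalCommRing L1T :=
  { (inferInstance : AddCommGroup L1T), (inferInstance : Mul L1T) with
    mul_comm := fun f g => toMT_injective (by rw [toMT_mul, toMT_mul, mul_comm])
    mul_assoc := fun f g h => toMT_injective (by simp only [toMT_mul, mul_assoc])
    left_distrib := fun f g h => toMT_injective (by simp only [toMT_mul, toMT_add, mul_add])
    right_distrib := fun f g h => toMT_injective (by simp only [toMT_mul, toMT_add, add_mul])
    zero_mul := fun f => toMT_injective (by
      have h0 : (0 : L1T).toMT = 0 := by simpa using toMT_smul 0 0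
      rw [toMT_mul, h0, zero_mul])
    mul_zero := fun f => toMT_injective (by
      have h0 : (0 : L1T).toMT = 0 := by simpa using toMT_smul 0 0
      rw [toMT_mul, h0, mul_zero]) }

/-- `L¹(𝕋)` with convolution and the `L¹` norm. -/
instance : NonUnitalNormedCommRing L1T :=
  { (inferInstance : NormedAddCommGroup L1T), (inferInstance : NonUnitalCommRing L1T) with
    norm_mul_le := fun f g => by
      rw [← norm_toMT, ← norm_toMT f, ← norm_toMT g, toMT_mul]
      exact norm_mul_le _ _ }

instance : IsScalarTower ℂ L1T L1T :=
  ⟨fun c f g => toMT_injective (by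
    simp only [smul_eq_mul, toMT_mul, toMT_smul, smul_mul_assoc])⟩

instance : SMulCommClass ℂ L1T L1T :=
  ⟨fun c f g => toMT_injective (by
    simp only [smul_eq_mul, toMT_mul, toMT_smul, mul_smul_comm])⟩

theorem exists_toMT_eq_iff (μ : MT) : (∃ f : L1T, f.toMT = μ) ↔
    ∀ s, MeasurableSet s → haarAddCircle (T := 1) s = 0 → μ.val s = 0 := by
  constructor
  · rintro ⟨f, rfl⟩ s hs h0
    rw [toMT_apply f hs, Measure.restrict_eq_zero.2 h0, integral_zero_measure]
  · intro h
    have hac : μ.val ≪ᵥ (haarAddCircle (T := 1)).toENNRealVectorMeasure := by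
      refine VectorMeasure.AbsolutelyContinuous.mk fun s hs h0 => ?_
      rw [Measure.toENNRealVectorMeasure_apply_measurable hs] at h0
      exact h s hs h0
    obtain ⟨h1, h2⟩ := (ComplexMeasure.absolutelyContinuous_ennreal_iff _ _).1 hac
    have r1 := SignedMeasure.withDensityᵥ_rnDeriv_eq _ _ h1
    have r2 := SignedMeasure.withDensityᵥ_rnDeriv_eq _ _ h2
    have i1 := SignedMeasure.integrable_rnDeriv (ComplexMeasure.re μ.val) (haarAddCircle (T := 1))
    have i2 := SignedMeasure.integrable_rnDeriv (ComplexMeasure.im μ.val) (haarAddCircle (T := 1))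
    have i3 := i1.ofReal (𝕜 := ℂ) |>.add ((i2.ofReal (𝕜 := ℂ)).mul_const Complex.I)
    refine ⟨mk _ i3, ?_⟩
    rw [toMT_mk]
    refine VectorMeasure.ext fun s hs => ?_
    rw [withDensityᵥ_apply i3 hs]
    have j1 := congrArg (fun σ => σ s) r1
    have j2 := congrArg (fun σ => σ s) r2
    simp only [withDensityᵥ_apply i1 hs, withDensityᵥ_apply i2 hs] at j1 j2
    simp only [Pi.add_apply]
    rw [integral_add (i1.ofReal (𝕜 := ℂ)).restrict ((i2.ofReal (𝕜 := ℂ)).mul_const _).restrict,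
      integral_mul_const, integral_ofReal, integral_ofReal, j1, j2]
    exact Complex.re_add_im (μ.val s)

/-- `L¹(𝕋)` is an ideal of `M(𝕋)`. -/
def idealMT : Ideal MT where
  carrier := {μ | ∃ f : L1T, f.toMT = μ}
  zero_mem' := ⟨0, by simpa using toMT_smul 0 0⟩
  add_mem' := by
    rintro _ _ ⟨f, rfl⟩ ⟨g, rfl⟩
    exact ⟨f + g, toMT_add f g⟩
  smul_mem' := by
    rintro ν _ ⟨f, rfl⟩
    refine (exists_toMT_eq_iff _).2 fun s hs h0 => ?_
    rw [smul_eq_mul]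
    change (cprod ν.val f.toMT.val).map _ s = 0
    rw [VectorMeasure.map_apply _ MT.add_measurable hs, cprod,
      VectorMeasure.prod_apply_eq_integral (MT.add_measurable hs)]
    have hz : ∀ x : UnitAddCircle, f.toMT.val
        (Prod.mk x ⁻¹' ((fun p : UnitAddCircle × UnitAddCircle => p.1 + p.2) ⁻¹' s)) = 0 := by
      intro x
      refine (exists_toMT_eq_iff _).1 ⟨f, rfl⟩ _
        (measurable_prodMk_left (MT.add_measurable hs)) ?_
      exact (measure_preimage_add (haarAddCircle (T := 1)) x s).trans h0
    simp [hz]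

end L1T

/-- `r(L¹(𝕋))`: the measures some convolution power (with exponent `≥ 1`) of which lies in
`L¹(𝕋)`. -/
def rootsL1 : Set MT := {μ | ∃ n : ℕ, 1 ≤ n ∧ ∃ f : L1T, f.toMT = μ ^ n}

theorem rootsL1_eq : rootsL1 = (L1T.idealMT.radical : Set MT) := by
  ext μ
  constructor
  · rintro ⟨n, -, h⟩
    exact ⟨n, h⟩
  · rintro ⟨n, h⟩
    exact ⟨n + 1, by omega, by rw [pow_succ]; exact L1T.idealMT.mul_mem_right _ h⟩

/-- The closure of `r(L¹(𝕋))` in `M(𝕋)`, as a closed subalgebra. -/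
def algA : NonUnitalSubalgebra ℂ MT where
  carrier := closure rootsL1
  zero_mem' := by
    rw [rootsL1_eq]
    exact L1T.idealMT.radical.closure.zero_mem
  add_mem' := by
    rw [rootsL1_eq]
    exact L1T.idealMT.radical.closure.add_mem
  mul_mem' := fun {a b} _ hb => by
    rw [rootsL1_eq] at *
    exact L1T.idealMT.radical.closure.mul_mem_left a hb
  smul_mem' := fun c x hx => by
    rw [rootsL1_eq] at *
    rw [Algebra.smul_def]
    exact L1T.idealMT.radical.closure.mul_mem_left _ hx

instance : NormedSpace ℂ algA :=
  { (inferInstance : Module ℂ algA) with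
    norm_smul_le := fun c x => norm_smul_le c (x : MT) }

section General

variable (R : Type*) [NonUnitalNormedCommRing R] [NormedSpace ℂ R]

/-- Semisimplicity: the characters separate the points from zero. -/
def IsGelfandSemisimple : Prop :=
  ∀ x : R, x ≠ 0 → ∃ φ : WeakDual.characterSpace ℂ R, φ x ≠ 0

variable {R}

/-- The Nevanlinna–Pick norm of `a` for the characters `φ 1, …, φ n`. -/
def npNorm {n : ℕ} (φ : Fin n → WeakDual.characterSpace ℂ R) (a : Fin n → ℂ) : ℝ :=
  sInf {r : ℝ | ∃ x : R, (∀ i, φ i x = a i) ∧ r = ‖x‖}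

end General

section Ideals

variable (R : Type*) [NonUnitalCommRing R] [Module ℂ R]

/-- An ideal of a commutative complex algebra that need not have a unit: a linear subspace stable
under multiplication by all elements. -/
structure AlgIdeal extends Submodule ℂ R where
  mul_mem' : ∀ (a : R) {x : R}, x ∈ carrier → a * x ∈ carrier

/-- A commutative complex algebra is radical if it has no nonzero multiplicative linear
functional. -/
def IsRadicalAlgebra : Prop := ∀ φ : R →ₙₐ[ℂ] ℂ, φ = 0

variable {R}

namespace AlgIdeal

/-- The quotient algebra. -/
def Quotient (I : AlgIdeal R) : Type _ := R ⧸ I.toSubmodule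

variable (I : AlgIdeal R)

instance : AddCommGroup I.Quotient := inferInstanceAs (AddCommGroup (R ⧸ I.toSubmodule))
instance : Module ℂ I.Quotient := inferInstanceAs (Module ℂ (R ⧸ I.toSubmodule))

/-- The coset of an element. -/
def coset (x : R) : I.Quotient := Submodule.Quotient.mk (p := I.toSubmodule) x

theorem coset_surjective : Function.Surjective I.coset := Submodule.Quotient.mk_surjective _

/-- Multiplication of cosets, `(x + I) (y + I) = x y + I`. -/
instance : Mul I.Quotient :=
  ⟨_root_.Quotient.map₂ (· * ·) fun x x' hx y y' hy => by
    have hx : x - x' ∈ I.toSubmodule := (Submodule.quotientRel_def _).1 hx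
    have hy : y - y' ∈ I.toSubmodule := (Submodule.quotientRel_def _).1 hy
    refine (Submodule.quotientRel_def I.toSubmodule).2 ?_
    have h : x * y - x' * y' = y * (x - x') + x' * (y - y') := by
      rw [mul_sub, mul_sub, mul_comm y x, mul_comm y x']; abel
    rw [h]
    exact I.add_mem (I.mul_mem' y hx) (I.mul_mem' x' hy)⟩

theorem coset_mul (x y : R) : I.coset (x * y) = I.coset x * I.coset y := rfl

theorem coset_add (x y : R) : I.coset (x + y) = I.coset x + I.coset y := rfl

instance : NonUnitalCommRing I.Quotient :=
  { (inferInstance : AddCommGroup I.Quotient), (inferInstance : Mul I.Quotient) with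
    mul_comm := fun a b => by
      obtain ⟨x, rfl⟩ := I.coset_surjective a
      obtain ⟨y, rfl⟩ := I.coset_surjective b
      rw [← coset_mul, mul_comm, coset_mul]
    mul_assoc := fun a b c => by
      obtain ⟨x, rfl⟩ := I.coset_surjective a
      obtain ⟨y, rfl⟩ := I.coset_surjective b
      obtain ⟨z, rfl⟩ := I.coset_surjective c
      simp only [← coset_mul, mul_assoc]
    left_distrib := fun a b c => by
      obtain ⟨x, rfl⟩ := I.coset_surjective a
      obtain ⟨y, rfl⟩ := I.coset_surjective b
      obtain ⟨z, rfl⟩ := I.coset_surjective c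
      simp only [← coset_mul, ← coset_add, mul_add]
    right_distrib := fun a b c => by
      obtain ⟨x, rfl⟩ := I.coset_surjective a
      obtain ⟨y, rfl⟩ := I.coset_surjective b
      obtain ⟨z, rfl⟩ := I.coset_surjective c
      simp only [← coset_mul, ← coset_add, add_mul]
    zero_mul := fun a => by
      obtain ⟨x, rfl⟩ := I.coset_surjective a
      change I.coset (0 * x) = I.coset 0
      rw [zero_mul]
    mul_zero := fun a => by
      obtain ⟨x, rfl⟩ := I.coset_surjective a
      change I.coset (x * 0) = I.coset 0
      rw [mul_zero] }

end AlgIdeal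

end Ideals

/-- `L¹(𝕋)` as an ideal of the closure of `r(L¹(𝕋))`. -/
def idealL1 : AlgIdeal algA where
  carrier := {μ | ∃ f : L1T, f.toMT = μ}
  zero_mem' := L1T.idealMT.zero_mem
  add_mem' := fun {a b} ha hb => L1T.idealMT.add_mem ha hb
  smul_mem' := by
    rintro c x ⟨f, hf⟩
    exact ⟨c • f, by rw [L1T.toMT_smul, hf]; rfl⟩
  mul_mem' := fun a x hx => L1T.idealMT.mul_mem_left (a : MT) hx

end CircleAlg

end

/-!
Write `e_k` for the exponential `x ↦ e^{2πikx}`. Since `μ * e_k = μ̂(k) e_k` for every measure `μ`,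
a character of an algebra between `L¹(𝕋)` and `M(𝕋)` that does not vanish at `e_k` is `μ ↦ μ̂(k)`.
A character vanishing at every `e_k` vanishes on `L¹(𝕋)`, hence on every measure with a convolution
power in `L¹(𝕋)`, hence on `A` by continuity. Thus `A` and `L¹(𝕋)` have Gelfand space `ℤ`, and
`A / L¹(𝕋)` is radical. Convolution with an approximate identity, followed by a correction by a
small trigonometric polynomial, moves a measure into `L¹(𝕋)` without changing finitely many
prescribed coefficients and almost without increasing the norm, so the Nevanlinna–Pick norms agree.

An isomorphism of `A` onto `L¹(𝕋)` would be continuous, by semisimplicity, and would preserve the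
lines spanned by the `e_k`, whose closed span is `L¹(𝕋)` in both algebras; so it would force
`A = L¹(𝕋)`. The Riesz product `ρ = ∏ (1 + (j + 1)^{-1/2} cos (2π 3^j x))` excludes this. The
fourth powers of its amplitudes are summable, so `ρ * ρ` has coefficients in `ℓ²` and lies in
`L¹(𝕋)`. Their squares are not, and then `ρ` is not absolutely continuous: the functions
`cos (2π 3^j x)` are uncorrelated both under `ρ` and under Haar measure, and suitably weighted means
of them converge in probability to different limits under the two measures.
-/

noncomputable section

open Filter MeasureTheory Set Topology WeakDual
open scoped ENNReal
open AddCircle (haarAddCircle)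

namespace CircleAlg

/-! ### Characters and quotients of Banach algebras -/

section BanachAlgebra

variable {B : Type*} [NonUnitalNormedRing B] [NormedSpace ℂ B] [IsScalarTower ℂ B B]
  [SMulCommClass ℂ B B] [CompleteSpace B]

theorem norm_nonUnitalAlgHom_apply_le (φ : B →ₙₐ[ℂ] ℂ) (x : B) : ‖φ x‖ ≤ ‖x‖ := by
  -- `φ` extends to the unitization with the `ℓ¹` norm, which is a unital Banach algebra.
  let ψ : WithLp 1 (Unitization ℂ B) →ₐ[ℂ] ℂ :=
    (Unitization.lift φ).comp (WithLp.unitizationAlgEquiv ℂ).toAlgHom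
  have hψ : ψ (WithLp.toLp 1 (x : Unitization ℂ B)) = φ x := by
    simp [ψ, Unitization.lift_apply]
  have hone : ‖(1 : WithLp 1 (Unitization ℂ B))‖ = 1 := by
    rw [WithLp.unitization_norm_def]
    change ‖(1 : ℂ)‖ + ‖(0 : B)‖ = 1
    simp
  have h := AlgHom.norm_apply_le_self_mul_norm_one ψ (WithLp.toLp 1 (x : Unitization ℂ B))
  rwa [hψ, hone, mul_one, WithLp.unitization_norm_inr] at h

theorem IsGelfandSemisimple.continuous_nonUnitalAlgHom {R : Type*} [NonUnitalNormedCommRing R]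
    [NormedSpace ℂ R] [CompleteSpace R] (hR : IsGelfandSemisimple R) (S : B →ₙₐ[ℂ] R) :
    Continuous S := by
  refine LinearMap.continuous_of_seq_closed_graph (S : B →ₗ[ℂ] R) fun u f x hu hx => ?_
  by_contra hne
  obtain ⟨φ, hφ⟩ := hR (x - S f) (sub_ne_zero.2 hne)
  have hφS : Continuous ((WeakDual.CharacterSpace.toNonUnitalAlgHom φ).comp S) :=
    AddMonoidHomClass.continuous_of_bound _ 1 fun g => by
      simpa only [one_mul] using norm_nonUnitalAlgHom_apply_le _ g
  have h₁ : Tendsto (fun n => φ (S (u n))) atTop (𝓝 (φ (S f))) := (hφS.tendsto f).comp hu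
  have h₂ : Tendsto (fun n => φ (S (u n))) atTop (𝓝 (φ x)) :=
    ((map_continuous φ).tendsto x).comp hx
  rw [map_sub, tendsto_nhds_unique h₂ h₁, sub_self] at hφ
  exact hφ rfl

end BanachAlgebra

theorem exists_coe_eq_pow_succ {A : Type*} [Ring A] [Algebra ℂ A] {S : NonUnitalSubalgebra ℂ A}
    (φ : S →ₙₐ[ℂ] ℂ) (x : S) (n : ℕ) :
    ∃ y : S, (y : A) = (x : A) ^ (n + 1) ∧ φ y = φ x ^ (n + 1) := by
  induction n with
  | zero => exact ⟨x, by simp⟩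
  | succ n ih =>
    obtain ⟨y, hy, hφy⟩ := ih
    exact ⟨y * x, by simp [hy, pow_succ _ (n + 1)], by rw [map_mul, hφy, pow_succ _ (n + 1)]⟩

theorem isRadicalAlgebra_quotient_iff {R : Type*} [NonUnitalCommRing R] [Module ℂ R]
    (I : AlgIdeal R) :
    IsRadicalAlgebra I.Quotient ↔ ∀ φ : R →ₙₐ[ℂ] ℂ, (∀ x ∈ I.toSubmodule, φ x = 0) → φ = 0 := by
  constructor
  · intro hI φ hφ
    let ψ : I.Quotient →ₙₐ[ℂ] ℂ :=
      { I.toSubmodule.liftQ (φ : R →ₗ[ℂ] ℂ) hφ with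
        map_zero' := map_zero (I.toSubmodule.liftQ (φ : R →ₗ[ℂ] ℂ) hφ)
        map_mul' := I.coset_surjective.forall₂.2 fun x y => map_mul φ x y }
    ext x
    exact DFunLike.congr_fun (hI ψ) (I.coset x)
  · intro hI ψ
    let φ : R →ₙₐ[ℂ] ℂ :=
      { (ψ : I.Quotient →ₗ[ℂ] ℂ).comp I.toSubmodule.mkQ with
        map_zero' := map_zero ((ψ : I.Quotient →ₗ[ℂ] ℂ).comp I.toSubmodule.mkQ)
        map_mul' := fun x y => map_mul ψ (I.coset x) (I.coset y) }
    have hφ : φ = 0 := hI φ fun x hx =>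
      (congrArg ψ ((Submodule.Quotient.mk_eq_zero I.toSubmodule).2 hx)).trans (map_zero ψ)
    ext x
    obtain ⟨x, rfl⟩ := I.coset_surjective x
    exact DFunLike.congr_fun hφ x

/-! ### Complex measures -/

section ComplexMeasure

variable {X : Type*} [MeasurableSpace X]

theorem exists_withDensityᵥ_eq {lam : Measure X} [SigmaFinite lam] {μ : ComplexMeasure X}
    (h : ∀ s, MeasurableSet s → lam s = 0 → μ s = 0) :
    ∃ f : X → ℂ, Integrable f lam ∧ lam.withDensityᵥ f = μ := by
  have hac : μ ≪ᵥ lam.toENNRealVectorMeasure := .mk fun s hs h0 =>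
    h s hs (by rwa [Measure.toENNRealVectorMeasure_apply_measurable hs] at h0)
  obtain ⟨hre, him⟩ := (ComplexMeasure.absolutelyContinuous_ennreal_iff _ _).1 hac
  have ire := SignedMeasure.integrable_rnDeriv (ComplexMeasure.re μ) lam
  have iim := SignedMeasure.integrable_rnDeriv (ComplexMeasure.im μ) lam
  have ire' := ire.ofReal (𝕜 := ℂ)
  have iim' := (iim.ofReal (𝕜 := ℂ)).mul_const Complex.I
  refine ⟨_, ire'.add iim', VectorMeasure.ext fun s hs => ?_⟩
  have ere := congrArg (fun σ => σ s) (SignedMeasure.withDensityᵥ_rnDeriv_eq _ _ hre)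
  have eim := congrArg (fun σ => σ s) (SignedMeasure.withDensityᵥ_rnDeriv_eq _ _ him)
  simp only [withDensityᵥ_apply ire hs, withDensityᵥ_apply iim hs] at ere eim
  simp only [withDensityᵥ_apply (ire'.add iim') hs, Pi.add_apply]
  rw [integral_add ire'.restrict iim'.restrict, integral_mul_const, integral_ofReal,
    integral_ofReal, ere, eim]
  exact Complex.re_add_im (μ s)

theorem isFiniteMeasure_variation_withDensityᵥ {lam : Measure X} {f : X → ℂ}
    (hf : Integrable f lam) : IsFiniteMeasure (lam.withDensityᵥ f).variation := by
  rw [Measure.variation_withDensityᵥ hf]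
  exact isFiniteMeasure_withDensity hf.2.ne

theorem integral_withDensityᵥ_simpleFunc {lam : Measure X} {f : X → ℂ} (hf : Integrable f lam)
    (g : SimpleFunc X ℂ) :
    (lam.withDensityᵥ f).integral g (ContinuousLinearMap.mul ℝ ℂ) = ∫ x, g x * f x ∂lam := by
  have := isFiniteMeasure_variation_withDensityᵥ hf
  have hgf : ∀ g : SimpleFunc X ℂ, Integrable (fun x => g x * f x) lam := fun g =>
    have ⟨C, hC⟩ := g.exists_forall_norm_le
    hf.bdd_mul g.aestronglyMeasurable (.of_forall hC)
  induction g using SimpleFunc.induction with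
  | @const c s hs =>
    have hind : ⇑(SimpleFunc.piecewise s hs (.const X c) (.const X 0)) =
        s.indicator fun _ => c := by
      classical exact piecewise_eq_indicator
    simp only [hind, ← indicator_mul_left s (fun _ => c) f]
    rw [integral_indicator hs, integral_const_mul, ← withDensityᵥ_apply hf hs]
    exact VectorMeasure.integral_indicator_const c hs
  | add _ hg hh =>
    rw [SimpleFunc.coe_add, VectorMeasure.integral_add (SimpleFunc.integrable_of_isFiniteMeasure _)
      (SimpleFunc.integrable_of_isFiniteMeasure _), hg, hh, ← integral_add (hgf _) (hgf _)]
    simp only [Pi.add_apply, add_mul]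

theorem integral_withDensityᵥ {lam : Measure X} {f g : X → ℂ} (hf : Integrable f lam)
    (hg : StronglyMeasurable g) {C : ℝ} (hC : ∀ x, ‖g x‖ ≤ C) :
    (lam.withDensityᵥ f).integral g (ContinuousLinearMap.mul ℝ ℂ) = ∫ x, g x * f x ∂lam := by
  have := isFiniteMeasure_variation_withDensityᵥ hf
  let u : ℕ → SimpleFunc X ℂ := hg.approxBounded |C|
  have hlim : ∀ x, Tendsto (fun n => u n x) atTop (𝓝 (g x)) := fun x =>
    hg.tendsto_approxBounded_of_norm_le ((hC x).trans (le_abs_self C))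
  have hu : ∀ n x, ‖u n x‖ ≤ |C| := fun n x => hg.norm_approxBounded_le (abs_nonneg C) n x
  have hleft : Tendsto (fun n => (lam.withDensityᵥ f).integral (u n) (ContinuousLinearMap.mul ℝ ℂ))
      atTop (𝓝 ((lam.withDensityᵥ f).integral g (ContinuousLinearMap.mul ℝ ℂ))) :=
    VectorMeasure.tendsto_integral_filter_of_norm_le_const
      (.of_forall fun n => (u n).aestronglyMeasurable)
      ⟨|C|, .of_forall fun n => .of_forall (hu n)⟩ (.of_forall hlim)
  refine tendsto_nhds_unique hleft ?_
  simp only [integral_withDensityᵥ_simpleFunc hf]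
  refine tendsto_integral_of_dominated_convergence (fun x => |C| * ‖f x‖)
    (fun n => (u n).aestronglyMeasurable.mul hf.aestronglyMeasurable) (hf.norm.const_mul |C|)
    (fun n => .of_forall fun x => ?_) (.of_forall fun x => (hlim x).mul_const (f x))
  rw [norm_mul]
  gcongr
  exact hu n x

theorem complexMeasure_eq_zero_of_forall_integral_eq_zero [TopologicalSpace X] [NormalSpace X]
    [BorelSpace X] {μ : ComplexMeasure X} [μ.variation.WeaklyRegular]
    (h : ∀ g : BoundedContinuousFunction X ℂ, μ.integral g (ContinuousLinearMap.mul ℝ ℂ) = 0) :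
    μ = 0 := by
  have hL : ∀ g : Lp ℂ 1 μ.variation, μ.integral g (ContinuousLinearMap.mul ℝ ℂ) = 0 := fun g =>
    (BoundedContinuousFunction.toLp_denseRange ℂ μ.variation ℂ ENNReal.one_ne_top).induction_on
      (p := fun g => μ.integral g (ContinuousLinearMap.mul ℝ ℂ) = 0) g
      (isClosed_singleton.preimage VectorMeasure.continuous_integral) fun g =>
        (VectorMeasure.integral_congr_ae (BoundedContinuousFunction.coeFn_toLp _ _ _ g)).trans (h g)
  ext s hs
  have hind : μ.integral (s.indicator fun _ => (1 : ℂ)) (ContinuousLinearMap.mul ℝ ℂ) = μ s :=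
    (VectorMeasure.integral_indicator_const 1 hs).trans (one_mul _)
  rw [← hind, zero_apply,
    ← hL (indicatorConstLp 1 hs (measure_ne_top μ.variation s) (1 : ℂ))]
  exact VectorMeasure.integral_congr_ae indicatorConstLp_coeFn.symm

end ComplexMeasure

namespace MT

/-- The isometric embedding `f ↦ f dλ` of `L¹(λ)` into `M(𝕋)`. -/
def ofLp (lam : Measure UnitAddCircle) : Lp ℂ 1 lam →ₗᵢ[ℂ] MT where
  toFun f := lam.withDensityᵥ f
  map_add' f g := (WithDensityᵥEq.congr_ae (Lp.coeFn_add f g)).trans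
    (withDensityᵥ_add (L1.integrable_coeFn f) (L1.integrable_coeFn g))
  map_smul' c f := (WithDensityᵥEq.congr_ae (Lp.coeFn_smul c f)).trans
    (withDensityᵥ_smul f c)
  norm_map' f := by
    have hf := L1.integrable_coeFn f
    change (lam.withDensityᵥ f).variation.real univ = ‖f‖
    rw [measureReal_def, Measure.variation_withDensityᵥ hf, withDensity_apply _ .univ,
      Measure.restrict_univ, Lp.norm_def, eLpNorm_one_eq_lintegral_enorm]

theorem exists_ofLp_eq {lam : Measure UnitAddCircle} [SigmaFinite lam] {μ : MT}
    (h : μ.val.variation ≪ lam) : ∃ f, ofLp lam f = μ := by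
  obtain ⟨f, hf, hμ⟩ := exists_withDensityᵥ_eq (lam := lam) (μ := μ.val) fun s _ h0 =>
    norm_le_zero_iff.1 ((VectorMeasure.norm_measure_le_variation (μ := μ.val)).trans_eq (by
      rw [measureReal_def, h h0, ENNReal.toReal_zero]))
  exact ⟨hf.toL1 f, (WithDensityᵥEq.congr_ae hf.coeFn_toL1).trans hμ⟩

instance : CompleteSpace MT := by
  refine NormedAddCommGroup.completeSpace_of_summable_imp_tendsto fun u hu => ?_
  let lam := Measure.sum fun n => (u n).val.variation
  have : IsFiniteMeasure lam := by
    refine ⟨?_⟩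
    rw [Measure.sum_apply _ .univ]
    simpa only [norm_def, ENNReal.ofReal_toReal (measure_ne_top _ _)] using
      hu.tsum_ofReal_lt_top
  choose f hf using fun n => exists_ofLp_eq
    (Measure.absolutelyContinuous_sum_right (μs := fun n => (u n).val.variation) n .rfl)
  have hsum : Summable fun n => ‖f n‖ := by
    simpa only [← (ofLp lam).norm_map, lam, hf] using hu
  refine ⟨ofLp lam (∑' n, f n), ?_⟩
  simpa only [Function.comp_def, map_sum, lam, hf] using
    ((ofLp lam).continuous.tendsto _).comp hsum.of_norm.hasSum.tendsto_sum_nat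

end MT

theorem integral_const_smul {X : Type*} [MeasurableSpace X] (μ : ComplexMeasure X) (c : ℂ)
    (g : X → ℂ) :
    μ.integral (c • g) (ContinuousLinearMap.mul ℝ ℂ) =
      c * μ.integral g (ContinuousLinearMap.mul ℝ ℂ) :=
  setToFun_smul _ (fun c s x => mul_assoc c x (μ s)) c g

theorem complexMeasure_eq_zero_of_dense_span {X : Type*} [MeasurableSpace X]
    [TopologicalSpace X] [NormalSpace X] [CompactSpace X] [BorelSpace X] {μ : ComplexMeasure X}
    [μ.variation.WeaklyRegular] {S : Set C(X, ℂ)}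
    (hS : (Submodule.span ℂ S).topologicalClosure = ⊤)
    (h : ∀ g ∈ S, μ.integral g (ContinuousLinearMap.mul ℝ ℂ) = 0) : μ = 0 := by
  have hint : ∀ g : C(X, ℂ), Integrable g μ.variation := fun g =>
    g.continuous.integrable_of_hasCompactSupport (.of_compactSpace g)
  let Λ : C(X, ℂ) →ₗ[ℂ] ℂ :=
    { toFun := fun g => μ.integral g (ContinuousLinearMap.mul ℝ ℂ)
      map_add' := fun f g => VectorMeasure.integral_add (hint f) (hint g)
      map_smul' := fun c g => integral_const_smul μ c g }
  have hΛ : Continuous Λ := AddMonoidHomClass.continuous_of_bound Λ (μ.variation.real univ)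
    fun g => by
      have := VectorMeasure.norm_integral_le_of_norm_le_const (μ := μ)
        (B := ContinuousLinearMap.mul ℝ ℂ) (.of_forall g.norm_coe_le_norm)
      rwa [ContinuousLinearMap.opNorm_mul, mul_one, mul_comm] at this
  have hker : Λ.ker = ⊤ := top_unique <| hS ▸ Submodule.topologicalClosure_minimal _
    (Submodule.span_le.2 h) (isClosed_singleton.preimage hΛ)
  exact complexMeasure_eq_zero_of_forall_integral_eq_zero fun g =>
    (hker ▸ Submodule.mem_top : g.toContinuousMap ∈ Λ.ker)

theorem MT.eq_zero_of_coeff_eq_zero {μ : MT} (h : ∀ k, μ.coeff k = 0) : μ = 0 := by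
  have hfourier : ∀ g ∈ range (fourier (T := 1)),
      μ.val.integral g (ContinuousLinearMap.mul ℝ ℂ) = 0 := by
    rintro _ ⟨k, rfl⟩
    simpa only [MT.coeff, neg_neg] using h (-k)
  have : μ.val.variation.WeaklyRegular := inferInstance
  exact complexMeasure_eq_zero_of_dense_span (μ := μ.val) span_fourier_closure_eq_top hfourier

theorem MT.coeff_withDensityᵥ {lam : Measure UnitAddCircle} {f : UnitAddCircle → ℂ}
    (hf : Integrable f lam) (k : ℤ) :
    MT.coeff (lam.withDensityᵥ f) k = ∫ x, fourier (-k) x * f x ∂lam :=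
  integral_withDensityᵥ hf (fourier (-k)).continuous.stronglyMeasurable
    (fourier (-k)).norm_coe_le_norm

/-- A finite positive measure, as an element of `M(𝕋)`. An infinite measure gives `0`. -/
def MT.ofMeasure (ρ : Measure UnitAddCircle) : MT := ρ.withDensityᵥ fun _ => (1 : ℂ)

theorem MT.ofMeasure_apply (ρ : Measure UnitAddCircle) [IsFiniteMeasure ρ]
    {s : Set UnitAddCircle} (hs : MeasurableSet s) :
    (MT.ofMeasure ρ).val s = ρ.real s := by
  refine (withDensityᵥ_apply (integrable_const _) hs).trans ?_
  simp

theorem MT.coeff_ofMeasure (ρ : Measure UnitAddCircle) [IsFiniteMeasure ρ] (k : ℤ) :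
    (MT.ofMeasure ρ).coeff k = ∫ x, fourier (-k) x ∂ρ :=
  (MT.coeff_withDensityᵥ (integrable_const 1) k).trans (by simp only [mul_one])

namespace L1T

theorem coeff_toMT (f : L1T) (k : ℤ) : f.toMT.coeff k = fourierCoeff f.fn k :=
  MT.coeff_withDensityᵥ f.integrable_fn k

theorem exists_coeff_eq_of_summable {c : ℤ → ℂ} (hc : Summable fun k => ‖c k‖ ^ 2) :
    ∃ f : L1T, ∀ k, f.toMT.coeff k = c k := by
  have hmem : Memℓp c 2 := memℓp_gen (by simpa using hc)
  let g : Lp ℂ 2 (haarAddCircle (T := 1)) := fourierBasis.repr.symm ⟨c, hmem⟩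
  have hg : Integrable g (haarAddCircle (T := 1)) := (Lp.memLp g).integrable one_le_two
  refine ⟨mk g hg, fun k => ?_⟩
  rw [coeff_toMT, fourierCoeff_congr_ae (fn_mk _ hg), ← fourierBasis_repr,
    LinearIsometryEquiv.apply_symm_apply]

/-- The exponential `x ↦ e^{2πikx}`. These are the minimal idempotents of `L¹(𝕋)`. -/
def char (k : ℤ) : L1T := (fourierLp 1 k : Lp ℂ 1 (haarAddCircle (T := 1)))

theorem fn_char (k : ℤ) : (char k).fn =ᵐ[haarAddCircle] fourier k := coeFn_fourierLp 1 k

theorem toMT_char_apply (k : ℤ) {s : Set UnitAddCircle} (hs : MeasurableSet s) :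
    (char k).toMT.val s = ∫ x in s, fourier k x ∂(haarAddCircle (T := 1)) :=
  (toMT_apply _ hs).trans (integral_congr_ae (ae_restrict_of_ae (fn_char k)))

theorem toMT_char_preimage_add (k : ℤ) (x : UnitAddCircle) {s : Set UnitAddCircle}
    (hs : MeasurableSet s) :
    (char k).toMT.val ((x + ·) ⁻¹' s) = (char k).toMT.val s * fourier (-k) x := by
  have hx : MeasurableSet ((x + ·) ⁻¹' s) := measurable_const_add x hs
  rw [toMT_char_apply k hx, toMT_char_apply k hs, ← integral_indicator hx, ← integral_indicator hs,
    ← integral_add_left_eq_self (s.indicator _) x, ← integral_mul_const]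
  congr 1 with y
  by_cases hy : x + y ∈ s
  · have hxy : fourier k (x + y) * fourier (-k) x = fourier k y := by
      rw [fourier_apply, fourier_apply, fourier_apply, ← Circle.coe_mul, ← AddCircle.toCircle_add]
      congr 2
      module
    rw [indicator_of_mem hy, indicator_of_mem (mem_preimage.2 hy), hxy]
  · rw [indicator_of_notMem hy, indicator_of_notMem (mt mem_preimage.1 hy), zero_mul]

theorem mul_toMT_char (μ : MT) (k : ℤ) : μ * (char k).toMT = μ.coeff k • (char k).toMT := by
  refine VectorMeasure.ext fun s hs => ?_
  change (cprod μ.val (char k).toMT.val).map _ s = μ.coeff k * (char k).toMT.val s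
  have htranslate : (fun x => (char k).toMT.val (Prod.mk x ⁻¹' ((fun p => p.1 + p.2) ⁻¹' s))) =
      (char k).toMT.val s • fun x => fourier (-k) x :=
    funext fun x => toMT_char_preimage_add k x hs
  rw [VectorMeasure.map_apply _ MT.add_measurable hs, cprod,
    VectorMeasure.prod_apply_eq_integral (MT.add_measurable hs), htranslate,
    show (ContinuousLinearMap.mul ℝ ℂ).flip = ContinuousLinearMap.mul ℝ ℂ by ext; simp,
    integral_const_smul, mul_comm]
  rfl

theorem norm_char (k : ℤ) : ‖char k‖ = 1 := by
  have hnorm : ‖char k‖ = (eLpNorm (char k).fn 1 (haarAddCircle (T := 1))).toReal := rfl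
  have henorm : ∀ x : UnitAddCircle, ‖fourier k x‖ₑ = 1 := fun x => by
    rw [← ofReal_norm, fourier_apply, Circle.norm_coe, ENNReal.ofReal_one]
  rw [hnorm, eLpNorm_congr_ae (fn_char k), eLpNorm_one_eq_lintegral_enorm,
    lintegral_congr henorm, lintegral_one, measure_univ, ENNReal.toReal_one]

theorem char_ne_zero (k : ℤ) : char k ≠ 0 := norm_ne_zero_iff.1 (by simp [norm_char])

theorem toMT_char_ne_zero (k : ℤ) : (char k).toMT ≠ 0 := by
  rw [← norm_ne_zero_iff, norm_toMT, norm_char]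
  exact one_ne_zero

theorem coeff_char (k j : ℤ) : (char k).toMT.coeff j = if j = k then 1 else 0 := by
  rw [coeff_toMT, fourierCoeff_congr_ae (fn_char k), fourierCoeff_fourier, Pi.single_apply]

theorem mul_char (f : L1T) (k : ℤ) : f * char k = f.toMT.coeff k • char k :=
  toMT_injective <| by rw [toMT_mul, mul_toMT_char, toMT_smul]

theorem eq_top_of_char_mem {S : Submodule ℂ L1T} (hS : IsClosed (S : Set L1T))
    (h : ∀ k, char k ∈ S) : S = ⊤ := by
  let S' : Submodule ℂ (Lp ℂ 1 (haarAddCircle (T := 1))) := S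
  have hspan : Submodule.span ℂ (range (fourierLp 1)) ≤ S' :=
    Submodule.span_le.2 (range_subset_iff.2 h)
  exact top_unique <| (span_fourierLp_closure_eq_top (T := 1) ENNReal.one_ne_top).symm.trans_le
    (Submodule.topologicalClosure_minimal _ hspan hS)

theorem exists_char_ne_zero {φ : L1T →ₙₐ[ℂ] ℂ} (hφ : φ ≠ 0) : ∃ k, φ (char k) ≠ 0 := by
  by_contra! h
  have hc : Continuous φ := AddMonoidHomClass.continuous_of_bound φ 1 fun x => by
    simpa only [one_mul] using norm_nonUnitalAlgHom_apply_le φ x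
  have hker : (φ : L1T →ₗ[ℂ] ℂ).ker = ⊤ :=
    eq_top_of_char_mem (isClosed_singleton.preimage hc) h
  exact hφ (NonUnitalAlgHom.ext fun f => (hker ▸ Submodule.mem_top : f ∈ (φ : L1T →ₗ[ℂ] ℂ).ker))

/-- The inclusion `f ↦ f dx` as a homomorphism of algebras. -/
def toMTₐ : L1T →ₙₐ[ℂ] MT where
  toFun := toMT
  map_smul' := toMT_smul
  map_zero' := by simpa using toMT_smul 0 0
  map_add' := toMT_add
  map_mul' := toMT_mul

theorem isClosed_range_toMT : IsClosed (range toMT) :=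
  (AddMonoidHomClass.isometry_of_norm toMTₐ norm_toMT).isClosedEmbedding.isClosed_range

end L1T

namespace MT

theorem coeff_eq_of_mul_eq {μ : MT} {k : ℤ} {c : ℂ}
    (h : μ * (L1T.char k).toMT = c • (L1T.char k).toMT) : μ.coeff k = c :=
  smul_left_injective ℂ (L1T.toMT_char_ne_zero k) ((L1T.mul_toMT_char μ k).symm.trans h)

/-- The `k`-th Fourier–Stieltjes coefficient as a multiplicative functional. -/
def coeffHom (k : ℤ) : MT →ₙₐ[ℂ] ℂ where
  toFun μ := μ.coeff k
  map_smul' c μ := coeff_eq_of_mul_eq (by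
    rw [smul_mul_assoc, L1T.mul_toMT_char, MonoidHom.id_apply, smul_assoc])
  map_zero' := coeff_eq_of_mul_eq (by rw [zero_mul, zero_smul])
  map_add' μ ν := coeff_eq_of_mul_eq (by
    rw [add_mul, L1T.mul_toMT_char, L1T.mul_toMT_char, add_smul])
  map_mul' μ ν := coeff_eq_of_mul_eq (by
    rw [mul_assoc, L1T.mul_toMT_char, mul_smul_comm, L1T.mul_toMT_char, smul_smul, mul_comm])

theorem norm_coeff_le (μ : MT) (k : ℤ) : ‖μ.coeff k‖ ≤ ‖μ‖ :=
  norm_nonUnitalAlgHom_apply_le (coeffHom k) μ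

theorem ext_coeff {μ ν : MT} (h : ∀ k, μ.coeff k = ν.coeff k) : μ = ν :=
  sub_eq_zero.1 <| eq_zero_of_coeff_eq_zero fun k =>
    (map_sub (coeffHom k) μ ν).trans (sub_eq_zero.2 (h k))

end MT

/-! ### Algebras between `L¹(𝕋)` and `M(𝕋)` -/

/-- A normed algebra between `L¹(𝕋)` and `M(𝕋)`: it embeds isometrically into `M(𝕋)`, and the
inclusion of `L¹(𝕋)` factors through it. -/
structure IntermediateAlgebra (R : Type*) [NonUnitalNormedCommRing R] [NormedSpace ℂ R] where
  /-- The embedding into `M(𝕋)`. -/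
  incl : R →ₙₐ[ℂ] MT
  norm_incl : ∀ x, ‖incl x‖ = ‖x‖
  /-- The embedding of `L¹(𝕋)`. -/
  ofL1 : L1T →ₙₐ[ℂ] R
  incl_ofL1 : ∀ f, incl (ofL1 f) = f.toMT

namespace IntermediateAlgebra

variable {R : Type*} [NonUnitalNormedCommRing R] [NormedSpace ℂ R] (A : IntermediateAlgebra R)

theorem incl_injective : Function.Injective A.incl :=
  (AddMonoidHomClass.isometry_of_norm A.incl A.norm_incl).injective

theorem norm_ofL1 (f : L1T) : ‖A.ofL1 f‖ = ‖f‖ := by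
  rw [← A.norm_incl, A.incl_ofL1, L1T.norm_toMT]

theorem ofL1_injective : Function.Injective A.ofL1 :=
  (AddMonoidHomClass.isometry_of_norm A.ofL1 A.norm_ofL1).injective

theorem ofL1_char_ne_zero (k : ℤ) : A.ofL1 (L1T.char k) ≠ 0 :=
  (map_ne_zero_iff A.ofL1 A.ofL1_injective).2 (L1T.char_ne_zero k)

theorem mul_ofL1_char (x : R) (k : ℤ) :
    x * A.ofL1 (L1T.char k) = (A.incl x).coeff k • A.ofL1 (L1T.char k) :=
  A.incl_injective <| by rw [map_mul, A.incl_ofL1, L1T.mul_toMT_char, map_smul, A.incl_ofL1]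

/-- The character `x ↦ x̂(k)`. -/
def coeffChar (k : ℤ) : characterSpace ℂ R :=
  let φ : R →ₙₐ[ℂ] ℂ := (MT.coeffHom k).comp A.incl
  have hφ : Continuous φ := AddMonoidHomClass.continuous_of_bound φ 1 fun x => by
    rw [one_mul, ← A.norm_incl]
    exact (A.incl x).norm_coeff_le k
  ⟨StrongDual.toWeakDual ⟨φ, hφ⟩, fun h => one_ne_zero (α := ℂ) <| by
    have h₀ : (A.incl (A.ofL1 (L1T.char k))).coeff k = 0 := DFunLike.congr_fun h _
    rwa [A.incl_ofL1, L1T.coeff_char, if_pos rfl] at h₀, map_mul φ⟩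

theorem coeffChar_apply (k : ℤ) (x : R) : A.coeffChar k x = (A.incl x).coeff k := rfl

theorem exists_coeffChar_ne_zero {x : R} (hx : x ≠ 0) : ∃ k, A.coeffChar k x ≠ 0 := by
  by_contra! h
  refine (map_ne_zero_iff A.incl A.incl_injective).2 hx (MT.ext_coeff fun k => ?_)
  exact (h k).trans (map_zero (MT.coeffHom k)).symm

theorem isGelfandSemisimple (A : IntermediateAlgebra R) : IsGelfandSemisimple R := fun _ hx =>
  have ⟨k, hk⟩ := A.exists_coeffChar_ne_zero hx
  ⟨A.coeffChar k, hk⟩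

theorem eq_coeffChar {φ : characterSpace ℂ R} {k : ℤ} (h : φ (A.ofL1 (L1T.char k)) ≠ 0) :
    φ = A.coeffChar k := by
  ext x
  refine mul_right_cancel₀ h ?_
  rw [← map_mul, A.mul_ofL1_char, map_smul, smul_eq_mul, coeffChar_apply]

theorem coeffChar_ofL1_char (k j : ℤ) :
    A.coeffChar k (A.ofL1 (L1T.char j)) = if k = j then 1 else 0 := by
  rw [coeffChar_apply, A.incl_ofL1, L1T.coeff_char]

theorem coeffChar_injective : Function.Injective A.coeffChar := fun k j hkj => by
  by_contra hne
  have h := A.coeffChar_ofL1_char k j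
  rw [hkj, coeffChar_ofL1_char, if_pos rfl, if_neg hne] at h
  exact one_ne_zero h

theorem isOpen_singleton_coeffChar (k : ℤ) : IsOpen {A.coeffChar k} := by
  have h : {A.coeffChar k} =
      {φ : characterSpace ℂ R | φ (A.ofL1 (L1T.char k)) ≠ 0} := by
    ext φ
    refine ⟨?_, A.eq_coeffChar⟩
    rintro rfl
    simp [coeffChar_ofL1_char]
  rw [h]
  exact isOpen_ne_fun ((WeakDual.eval_continuous _).comp continuous_subtype_val) continuous_const

theorem coeffChar_surjective (hA : ∀ φ : R →ₙₐ[ℂ] ℂ, φ.comp A.ofL1 = 0 → φ = 0) :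
    Function.Surjective A.coeffChar := fun φ => by
  have hφ : CharacterSpace.toNonUnitalAlgHom φ ≠ 0 := fun h =>
    φ.2.1 (DFunLike.ext _ _ fun x => DFunLike.congr_fun h x)
  obtain ⟨k, hk⟩ := L1T.exists_char_ne_zero (mt (hA _) hφ)
  exact ⟨k, (A.eq_coeffChar hk).symm⟩

/-- If no nonzero character of `R` vanishes on `L¹(𝕋)`, then the Gelfand space of `R` is `ℤ`. -/
def coeffHomeomorph (hA : ∀ φ : R →ₙₐ[ℂ] ℂ, φ.comp A.ofL1 = 0 → φ = 0) :
    ℤ ≃ₜ characterSpace ℂ R :=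
  have : DiscreteTopology (characterSpace ℂ R) := discreteTopology_iff_isOpen_singleton.2
    ((A.coeffChar_surjective hA).forall.2 A.isOpen_singleton_coeffChar)
  (Equiv.ofBijective A.coeffChar
    ⟨A.coeffChar_injective, A.coeffChar_surjective hA⟩).toHomeomorphOfDiscrete

theorem apply_char_mem_range {T : R →ₙₐ[ℂ] L1T} {S : L1T →ₙₐ[ℂ] R} (hTS : ∀ f, T (S f) = f)
    (hST : ∀ x, S (T x) = x) (j : ℤ) : S (L1T.char j) ∈ range A.ofL1 := by
  have hne : S (L1T.char j) ≠ 0 := fun h =>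
    L1T.char_ne_zero j (by rw [← hTS (L1T.char j), h, map_zero])
  obtain ⟨k, hk⟩ := A.exists_coeffChar_ne_zero hne
  have hSmul : S (L1T.char j) * A.ofL1 (L1T.char k) =
      (T (A.ofL1 (L1T.char k))).toMT.coeff j • S (L1T.char j) := by
    rw [← map_smul, ← L1T.mul_char, map_mul, hST, mul_comm]
  rw [A.mul_ofL1_char] at hSmul
  have hd : (T (A.ofL1 (L1T.char k))).toMT.coeff j ≠ 0 := fun hd => by
    rw [hd, zero_smul] at hSmul
    exact smul_ne_zero hk (A.ofL1_char_ne_zero k) hSmul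
  refine ⟨((T (A.ofL1 (L1T.char k))).toMT.coeff j)⁻¹ •
    (A.incl (S (L1T.char j))).coeff k • L1T.char k, ?_⟩
  rw [map_smul, map_smul, hSmul, inv_smul_smul₀ hd]

theorem ofL1_surjective_of_bijective [CompleteSpace R] (A : IntermediateAlgebra R)
    {T : R →ₙₐ[ℂ] L1T} (hT : Function.Bijective T) : Function.Surjective A.ofL1 := by
  obtain ⟨S, hST, hTS⟩ := Function.bijective_iff_has_inverse.1 hT
  let S' : L1T →ₙₐ[ℂ] R := T.inverse S hST hTS
  let I : Submodule ℂ R := LinearMap.range (A.ofL1 : L1T →ₗ[ℂ] R)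
  have hI : IsClosed (I : Set R) :=
    (AddMonoidHomClass.isometry_of_norm A.ofL1 A.norm_ofL1).isClosedEmbedding.isClosed_range
  have hchar : ∀ j, S' (L1T.char j) ∈ I := fun j =>
    A.apply_char_mem_range (T := T) (S := S') hTS hST j
  have htop : I.comap (S' : L1T →ₗ[ℂ] R) = ⊤ :=
    L1T.eq_top_of_char_mem (hI.preimage (A.isGelfandSemisimple.continuous_nonUnitalAlgHom S')) hchar
  intro x
  have hx : T x ∈ I.comap (S' : L1T →ₗ[ℂ] R) := htop ▸ Submodule.mem_top
  rw [← hST x]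
  exact hx

end IntermediateAlgebra

theorem L1T.norm_mk (g : UnitAddCircle → ℂ) (hg : Integrable g (haarAddCircle (T := 1))) :
    ‖mk g hg‖ = ∫ x, ‖g x‖ ∂(haarAddCircle (T := 1)) :=
  L1.norm_of_fun_eq_integral_norm hg

theorem exists_norm_eq_one_norm_coeff_sub_one_le (F : Finset ℤ) {ε : ℝ} (hε : 0 < ε) :
    ∃ K : L1T, ‖K‖ = 1 ∧ ∀ k ∈ F, ‖K.toMT.coeff k - 1‖ ≤ ε := by
  let U : Set UnitAddCircle := ⋂ k ∈ F, {x | ‖fourier (-k) x - 1‖ < ε}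
  have hU : IsOpen U := isOpen_biInter_finset fun k _ =>
    isOpen_lt (((fourier (-k)).continuous.sub continuous_const).norm) continuous_const
  have h0 : (0 : UnitAddCircle) ∈ U := mem_iInter₂.2 fun k _ => by simpa using hε
  set m := (haarAddCircle (T := 1)).real U with hm
  have hpos : 0 < m := ENNReal.toReal_pos (hU.measure_pos _ ⟨0, h0⟩).ne' (measure_ne_top _ _)
  let g : UnitAddCircle → ℂ := U.indicator fun _ => (m⁻¹ : ℝ)
  have hg : Integrable g (haarAddCircle (T := 1)) :=
    (integrable_const _).indicator hU.measurableSet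
  have hgint : ∫ x, g x ∂(haarAddCircle (T := 1)) = 1 := by
    rw [integral_indicator_const _ hU.measurableSet, ← hm, Complex.real_smul,
      ← Complex.ofReal_mul, mul_inv_cancel₀ hpos.ne', Complex.ofReal_one]
  have hgnorm : ∫ x, ‖g x‖ ∂(haarAddCircle (T := 1)) = 1 := by
    simp only [g, norm_indicator_eq_indicator_norm, Complex.norm_real, norm_inv,
      Real.norm_of_nonneg hpos.le]
    rw [integral_indicator_const _ hU.measurableSet, ← hm, smul_eq_mul, mul_inv_cancel₀ hpos.ne']
  refine ⟨.mk g hg, (L1T.norm_mk g hg).trans hgnorm, fun k hk => ?_⟩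
  have hle : ∀ x, ‖fourier (-k) x • g x - g x‖ ≤ ε * ‖g x‖ := fun x => by
    by_cases hx : x ∈ U
    · rw [smul_eq_mul, ← sub_one_mul, norm_mul]
      gcongr
      exact (mem_iInter₂.1 hx k hk).le
    · simp [g, hx]
  rw [L1T.coeff_toMT, fourierCoeff_congr_ae (L1T.fn_mk g hg), fourierCoeff, ← hgint,
    ← integral_sub (hg.fourier_smul _) hg]
  refine (norm_integral_le_of_norm_le (hg.norm.const_mul ε) (.of_forall hle)).trans_eq ?_
  rw [integral_const_mul, hgnorm, mul_one]

theorem exists_coeff_eq_norm_le_sum (F : Finset ℤ) (d : ℤ → ℂ) :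
    ∃ p : L1T, (∀ k ∈ F, p.toMT.coeff k = d k) ∧ ‖p‖ ≤ ∑ k ∈ F, ‖d k‖ := by
  refine ⟨∑ j ∈ F, d j • L1T.char j, fun k hk => ?_, norm_sum_le_of_le F fun j _ => ?_⟩
  · let φ : L1T →ₙₐ[ℂ] ℂ := (MT.coeffHom k).comp L1T.toMTₐ
    have hchar : ∀ j, φ (L1T.char j) = if k = j then 1 else 0 := fun j => L1T.coeff_char j k
    change φ (∑ j ∈ F, d j • L1T.char j) = d k
    simp only [map_sum, map_smul, hchar, smul_eq_mul, mul_ite, mul_one, mul_zero,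
      Finset.sum_ite_eq, hk, if_true]
  · rw [norm_smul, L1T.norm_char, mul_one]

theorem exists_coeff_eq_norm_le (F : Finset ℤ) (μ : MT) {ε : ℝ} (hε : 0 < ε) :
    ∃ f : L1T, (∀ k ∈ F, f.toMT.coeff k = μ.coeff k) ∧ ‖f‖ ≤ ‖μ‖ + ε := by
  let δ := ε / (F.card * ‖μ‖ + 1)
  obtain ⟨K, hK, hKcoeff⟩ := exists_norm_eq_one_norm_coeff_sub_one_le F
    (show 0 < δ by positivity)
  obtain ⟨g, hg⟩ : ∃ g : L1T, g.toMT = μ * K.toMT := L1T.idealMT.mul_mem_left μ ⟨K, rfl⟩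
  have hgnorm : ‖g‖ ≤ ‖μ‖ := by
    rw [← L1T.norm_toMT, hg]
    refine (norm_mul_le _ _).trans_eq ?_
    rw [L1T.norm_toMT, hK, mul_one]
  have hd : ∀ k ∈ F, ‖μ.coeff k - g.toMT.coeff k‖ ≤ ‖μ‖ * δ := fun k hk => by
    have hmul : g.toMT.coeff k = μ.coeff k * K.toMT.coeff k := hg ▸ map_mul (MT.coeffHom k) _ _
    rw [hmul, ← mul_one_sub, norm_mul, norm_sub_rev]
    exact mul_le_mul (μ.norm_coeff_le k) (hKcoeff k hk) (norm_nonneg _) (norm_nonneg _)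
  obtain ⟨p, hp, hpnorm⟩ := exists_coeff_eq_norm_le_sum F fun k => μ.coeff k - g.toMT.coeff k
  refine ⟨g + p, fun k hk => ?_, (norm_add_le _ _).trans (add_le_add hgnorm (hpnorm.trans ?_))⟩
  · rw [L1T.toMT_add]
    exact (map_add (MT.coeffHom k) _ _).trans ((congrArg _ (hp k hk)).trans (add_sub_cancel _ _))
  · calc ∑ k ∈ F, ‖μ.coeff k - g.toMT.coeff k‖ ≤ F.card • (‖μ‖ * δ) :=
          Finset.sum_le_card_nsmul _ _ _ hd
      _ = ε * ((F.card * ‖μ‖) / (F.card * ‖μ‖ + 1)) := by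
          rw [nsmul_eq_mul]
          ring
      _ ≤ ε := mul_le_of_le_one_right hε.le ((div_le_one (by positivity)).2 (by linarith))

/-- `L¹(𝕋)` itself as an algebra between `L¹(𝕋)` and `M(𝕋)`. -/
def L1T.intermediateAlgebra : IntermediateAlgebra L1T where
  incl := L1T.toMTₐ
  norm_incl := L1T.norm_toMT
  ofL1 := NonUnitalAlgHom.id ℂ L1T
  incl_ofL1 _ := rfl

theorem IntermediateAlgebra.npNorm_coeffChar {R : Type*} [NonUnitalNormedCommRing R]
    [NormedSpace ℂ R] (A : IntermediateAlgebra R) {n : ℕ} (k : Fin n → ℤ) (a : Fin n → ℂ) :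
    npNorm (fun i => A.coeffChar (k i)) a =
      npNorm (fun i => L1T.intermediateAlgebra.coeffChar (k i)) a := by
  set s := {r | ∃ x : R, (∀ i, A.coeffChar (k i) x = a i) ∧ r = ‖x‖}
  set t := {r | ∃ f : L1T, (∀ i, L1T.intermediateAlgebra.coeffChar (k i) f = a i) ∧ r = ‖f‖}
  have hbdd : BddBelow s := ⟨0, by rintro _ ⟨x, -, rfl⟩; exact norm_nonneg x⟩
  have hts : t ⊆ s := by
    rintro _ ⟨f, hf, rfl⟩
    exact ⟨A.ofL1 f, fun i => by rw [coeffChar_apply, A.incl_ofL1, ← hf]; rfl, (A.norm_ofL1 f).symm⟩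
  have hst : ∀ r ∈ s, ∀ ε > 0, ∃ r' ∈ t, r' ≤ r + ε := by
    rintro _ ⟨x, hx, rfl⟩ ε hε
    obtain ⟨f, hf, hfx⟩ := exists_coeff_eq_norm_le (Finset.univ.image k) (A.incl x) hε
    refine ⟨_, ⟨f, fun i => ?_, rfl⟩, by rwa [A.norm_incl] at hfx⟩
    rw [← hx i]
    exact hf (k i) (Finset.mem_image_of_mem k (Finset.mem_univ i))
  change sInf s = sInf t
  rcases s.eq_empty_or_nonempty with hempty | ⟨r, hr⟩
  · rw [hempty, subset_eq_empty hts hempty]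
  · obtain ⟨r₀, hr₀, -⟩ := hst r hr 1 one_pos
    refine le_antisymm (csInf_le_csInf hbdd ⟨r₀, hr₀⟩ hts) ?_
    refine le_csInf ⟨r, hr⟩ fun r hr => le_of_forall_pos_le_add fun ε hε => ?_
    obtain ⟨r', hr', hle⟩ := hst r hr ε hε
    exact (csInf_le (hbdd.mono hts) hr').trans hle

namespace L1T

theorem toMT_mem_algA (f : L1T) : f.toMT ∈ algA :=
  subset_closure ⟨1, le_rfl, f, (pow_one _).symm⟩

theorem not_isRadicalAlgebra_quotient (I : AlgIdeal L1T) (hI : IsClosed I.carrier)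
    (htop : I.toSubmodule ≠ ⊤) : ¬ IsRadicalAlgebra I.Quotient := by
  rw [isRadicalAlgebra_quotient_iff]
  intro hrad
  obtain ⟨k, hk⟩ : ∃ k, char k ∉ I.toSubmodule := by
    by_contra! h
    exact htop (eq_top_of_char_mem hI h)
  let φ : L1T →ₙₐ[ℂ] ℂ := (MT.coeffHom k).comp toMTₐ
  have hφ : φ = 0 := hrad φ fun f hf => by
    by_contra hne
    have hmem := I.mul_mem' (char k) hf
    rw [mul_comm, mul_char] at hmem
    exact hk ((I.toSubmodule.smul_mem_iff hne).1 hmem)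
  have hone : φ (char k) = 1 := (coeff_char k k).trans (if_pos rfl)
  rw [hφ] at hone
  exact zero_ne_one hone

end L1T

namespace algA

instance : CompleteSpace algA :=
  (isClosed_closure : IsClosed (closure rootsL1)).completeSpace_coe

/-- `A` as an algebra between `L¹(𝕋)` and `M(𝕋)`. -/
def intermediateAlgebra : IntermediateAlgebra algA where
  incl := NonUnitalSubalgebraClass.subtype algA
  norm_incl _ := rfl
  ofL1 := NonUnitalAlgHom.codRestrict L1T.toMTₐ algA L1T.toMT_mem_algA
  incl_ofL1 _ := rfl

theorem eq_zero_of_mem_rootsL1 {φ : algA →ₙₐ[ℂ] ℂ}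
    (hφ : φ.comp intermediateAlgebra.ofL1 = 0) {x : algA} (hx : (x : MT) ∈ rootsL1) : φ x = 0 := by
  obtain ⟨n, hn, f, hf⟩ := hx
  obtain ⟨n, rfl⟩ := Nat.exists_eq_add_of_le' hn
  obtain ⟨y, hy, hφy⟩ := exists_coe_eq_pow_succ φ x n
  have hyf : y = intermediateAlgebra.ofL1 f := Subtype.ext (hy.trans hf.symm)
  refine pow_eq_zero_iff n.succ_ne_zero |>.1 (hφy.symm.trans ?_)
  rw [hyf]
  exact DFunLike.congr_fun hφ f

theorem eq_zero_of_comp_ofL1_eq_zero (φ : algA →ₙₐ[ℂ] ℂ)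
    (hφ : φ.comp intermediateAlgebra.ofL1 = 0) : φ = 0 := by
  ext x
  refine norm_le_zero_iff.1 (le_of_forall_pos_le_add fun ε hε => ?_)
  obtain ⟨y, hy, hxy⟩ := Metric.mem_closure_iff.1 (show (x : MT) ∈ closure rootsL1 from x.2) ε hε
  let y' : algA := ⟨y, subset_closure hy⟩
  calc ‖φ x‖ = ‖φ (x - y')‖ := by rw [map_sub, eq_zero_of_mem_rootsL1 (x := y') hφ hy, sub_zero]
    _ ≤ ‖x - y'‖ := norm_nonUnitalAlgHom_apply_le φ _
    _ ≤ 0 + ε := by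
      rw [zero_add]
      exact (dist_eq_norm (x : MT) y ▸ hxy).le

end algA

theorem isClosed_idealL1 : IsClosed idealL1.carrier :=
  L1T.isClosed_range_toMT.preimage continuous_subtype_val

theorem isRadicalAlgebra_quotient_idealL1 : IsRadicalAlgebra idealL1.Quotient :=
  (isRadicalAlgebra_quotient_iff _).2 fun φ hφ => algA.eq_zero_of_comp_ofL1_eq_zero φ <|
    NonUnitalAlgHom.ext fun f => hφ _ ⟨f, rfl⟩

theorem idealL1_eq_top_of_bijective {T : algA →ₙₐ[ℂ] L1T} (hT : Function.Bijective T) :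
    idealL1.toSubmodule = ⊤ :=
  top_unique fun x _ =>
    have ⟨f, hf⟩ := algA.intermediateAlgebra.ofL1_surjective_of_bijective hT x
    ⟨f, congrArg Subtype.val hf⟩

/-! ### Second moments and absolute continuity -/

section SecondMoment

open ProbabilityTheory

variable {Ω ι : Type*} [MeasurableSpace Ω] {μ ν : Measure Ω}

theorem tendsto_measure_zero_of_absolutelyContinuous [IsFiniteMeasure μ] [SigmaFinite ν]
    (h : μ ≪ ν) {l : Filter ι} {s : ι → Set Ω} (hs : Tendsto (fun i => ν (s i)) l (𝓝 0)) :
    Tendsto (fun i => μ (s i)) l (𝓝 0) := by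
  simpa only [Measure.setLIntegral_rnDeriv h] using
    tendsto_setLIntegral_zero (Measure.lintegral_rnDeriv_lt_top μ ν).ne hs

theorem tendsto_measure_le_abs_sub_integral [IsFiniteMeasure μ] {l : Filter ι} {X : ι → Ω → ℝ}
    (hX : ∀ i, MemLp (X i) 2 μ) (hvar : Tendsto (fun i => Var[X i; μ]) l (𝓝 0)) {c : ℝ}
    (hc : 0 < c) : Tendsto (fun i => μ {ω | c ≤ |X i ω - μ[X i]|}) l (𝓝 0) := by
  have hbound := ENNReal.tendsto_ofReal (hvar.div_const (c ^ 2))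
  rw [zero_div, ENNReal.ofReal_zero] at hbound
  exact tendsto_of_tendsto_of_tendsto_of_le_of_le tendsto_const_nhds hbound
    (fun _ => zero_le) fun i => meas_ge_le_variance_div_sq (hX i) hc

theorem not_absolutelyContinuous_of_tendsto_variance [IsProbabilityMeasure μ] [IsFiniteMeasure ν]
    {l : Filter ι} [l.NeBot] {X : ι → Ω → ℝ} (hXμ : ∀ i, MemLp (X i) 2 μ)
    (hXν : ∀ i, MemLp (X i) 2 ν) (hμ : Tendsto (fun i => Var[X i; μ]) l (𝓝 0))
    (hν : Tendsto (fun i => Var[X i; ν]) l (𝓝 0)) (hgap : ∀ᶠ i in l, μ[X i] - ν[X i] = 1) :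
    ¬ μ ≪ ν := by
  intro hac
  have hfar_ν := tendsto_measure_zero_of_absolutelyContinuous hac
    (tendsto_measure_le_abs_sub_integral hXν hν one_half_pos)
  have hfar_μ := tendsto_measure_le_abs_sub_integral hXμ hμ one_half_pos
  have hsum := hfar_μ.add hfar_ν
  rw [add_zero] at hsum
  refine absurd (ge_of_tendsto hsum (hgap.mono fun i hi => ?_)) one_ne_zero.bot_lt.not_ge
  have hcover : {ω | 1 / 2 ≤ |X i ω - μ[X i]|} ∪ {ω | 1 / 2 ≤ |X i ω - ν[X i]|} = univ := by
    refine eq_univ_of_forall fun ω => ?_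
    by_contra hω
    simp only [mem_union, mem_ofPred_eq, not_or, not_le, abs_lt] at hω
    linarith
  calc (1 : ℝ≥0∞) = μ univ := measure_univ.symm
    _ ≤ _ := hcover ▸ measure_union_le _ _

theorem variance_sum_le_of_covariance_eq_zero [IsFiniteMeasure μ] {X : ι → Ω → ℝ}
    (hX : ∀ i, MemLp (X i) 2 μ) (hcov : Pairwise fun i j => cov[X i, X j; μ] = 0) {V : ℝ}
    (hvar : ∀ i, Var[X i; μ] ≤ V) (c : ι → ℝ) (s : Finset ι) :
    Var[∑ i ∈ s, c i • X i; μ] ≤ V * ∑ i ∈ s, c i ^ 2 := by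
  rw [variance_sum' fun i _ => (hX i).const_smul (c i), Finset.mul_sum]
  refine Finset.sum_le_sum fun i hi => ?_
  rw [Finset.sum_eq_single_of_mem i hi fun j _ hij => by
      rw [covariance_smul_left, covariance_smul_right, hcov hij.symm, mul_zero, mul_zero],
    covariance_self ((hX i).const_smul (c i)).aemeasurable, variance_smul, mul_comm]
  exact mul_le_mul_of_nonneg_right (hvar i) (sq_nonneg _)

theorem tendsto_variance_weighted_mean [IsFiniteMeasure μ] {X : ℕ → Ω → ℝ}
    (hX : ∀ i, MemLp (X i) 2 μ) (hcov : Pairwise fun i j => cov[X i, X j; μ] = 0) {V : ℝ}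
    (hvar : ∀ i, Var[X i; μ] ≤ V) {c : ℕ → ℝ}
    (hc : Tendsto (fun n => ∑ i ∈ Finset.range n, c i ^ 2) atTop atTop) :
    Tendsto (fun n => Var[(∑ i ∈ Finset.range n, c i ^ 2)⁻¹ • ∑ i ∈ Finset.range n, c i • X i; μ])
      atTop (𝓝 0) := by
  have hbound := hc.inv_tendsto_atTop.const_mul V
  rw [mul_zero] at hbound
  refine squeeze_zero' (.of_forall fun n => variance_nonneg _ _) ?_ hbound
  filter_upwards [hc.eventually_gt_atTop 0] with n hn
  rw [variance_smul, Pi.inv_apply]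
  calc _ ≤ (∑ i ∈ Finset.range n, c i ^ 2)⁻¹ ^ 2 * (V * ∑ i ∈ Finset.range n, c i ^ 2) :=
        mul_le_mul_of_nonneg_left (variance_sum_le_of_covariance_eq_zero hX hcov hvar c _)
          (sq_nonneg _)
    _ = V * (∑ i ∈ Finset.range n, c i ^ 2)⁻¹ := by field_simp

theorem not_absolutelyContinuous_of_tendsto_sum_sq [IsProbabilityMeasure μ] [IsFiniteMeasure ν]
    {X : ℕ → Ω → ℝ} (hXμ : ∀ i, MemLp (X i) 2 μ) (hXν : ∀ i, MemLp (X i) 2 ν)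
    (hμ : Pairwise fun i j => cov[X i, X j; μ] = 0) (hν : Pairwise fun i j => cov[X i, X j; ν] = 0)
    {V : ℝ} (hVμ : ∀ i, Var[X i; μ] ≤ V) (hVν : ∀ i, Var[X i; ν] ≤ V)
    (hgap : Tendsto (fun n => ∑ i ∈ Finset.range n, (μ[X i] - ν[X i]) ^ 2) atTop atTop) :
    ¬ μ ≪ ν := by
  -- Weighting `X i` by the gap itself, the normalized sums have means at distance exactly `1`.
  let c : ℕ → ℝ := fun i => μ[X i] - ν[X i]
  let S : ℕ → ℝ := fun n => ∑ i ∈ Finset.range n, c i ^ 2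
  have hmem : ∀ {P : Measure Ω}, (∀ i, MemLp (X i) 2 P) → ∀ n,
      MemLp ((S n)⁻¹ • ∑ i ∈ Finset.range n, c i • X i) 2 P := fun hX n =>
    (memLp_finsetSum' _ fun i _ => (hX i).const_smul (c i)).const_smul _
  have hmean : ∀ {P : Measure Ω} [IsFiniteMeasure P], (∀ i, MemLp (X i) 2 P) → ∀ n,
      P[(S n)⁻¹ • ∑ i ∈ Finset.range n, c i • X i] =
        (S n)⁻¹ * ∑ i ∈ Finset.range n, c i * P[X i] := fun hX n => by
    simp only [Pi.smul_apply, Finset.sum_apply, smul_eq_mul]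
    rw [integral_const_mul, integral_finsetSum _ fun i _ =>
      ((hX i).integrable one_le_two).const_mul (c i)]
    simp only [integral_const_mul]
  refine not_absolutelyContinuous_of_tendsto_variance (l := atTop) (hmem hXμ) (hmem hXν)
    (tendsto_variance_weighted_mean hXμ hμ hVμ hgap)
    (tendsto_variance_weighted_mean hXν hν hVν hgap) ?_
  filter_upwards [hgap.eventually_gt_atTop 0] with n hn
  rw [hmean hXμ, hmean hXν, ← mul_sub, ← Finset.sum_sub_distrib, inv_mul_eq_one₀ hn.ne']
  exact Finset.sum_congr rfl fun i _ => by rw [← mul_sub, sq]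

end SecondMoment

/-! ### Riesz products -/

section RieszProduct

open ProbabilityTheory

/-- The trigonometric polynomial `∏_{j < n} (1 + a_j cos (2π 3^j x))`, a partial product of the
Riesz product with amplitudes `a`. -/
def rieszProd (a : ℕ → ℝ) (n : ℕ) (x : UnitAddCircle) : ℝ :=
  ∏ j ∈ Finset.range n, (1 + a j * (fourier (3 ^ j) x).re)

/-- The Fourier coefficients of `rieszProd a n`, one factor of the product at a time. -/
def rieszCoeff (a : ℕ → ℝ) : ℕ → ℤ → ℝ
  | 0, k => if k = 0 then 1 else 0
  | n + 1, k => rieszCoeff a n k +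
      a n / 2 * (rieszCoeff a n (k - 3 ^ n) + rieszCoeff a n (k + 3 ^ n))

variable {a b : ℕ → ℝ} {n m : ℕ} {k l : ℤ}

theorem rieszCoeff_zero (a : ℕ → ℝ) (k : ℤ) : rieszCoeff a 0 k = if k = 0 then 1 else 0 := rfl

theorem rieszCoeff_succ (a : ℕ → ℝ) (n : ℕ) (k : ℤ) : rieszCoeff a (n + 1) k = rieszCoeff a n k +
    a n / 2 * (rieszCoeff a n (k - 3 ^ n) + rieszCoeff a n (k + 3 ^ n)) := rfl

theorem rieszCoeff_neg (a : ℕ → ℝ) (n : ℕ) (k : ℤ) : rieszCoeff a n (-k) = rieszCoeff a n k := by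
  induction n generalizing k with
  | zero => simp only [rieszCoeff_zero, neg_eq_zero]
  | succ n ih =>
    rw [rieszCoeff_succ, rieszCoeff_succ, ih, ← neg_add', neg_add_eq_sub, ← neg_sub k, ih, ih,
      add_comm (rieszCoeff a n (k + 3 ^ n))]

theorem rieszCoeff_eq_zero (h : 3 ^ n ≤ 2 * |k|) : rieszCoeff a n k = 0 := by
  induction n generalizing k with
  | zero =>
    rw [rieszCoeff_zero, if_neg]
    rintro rfl
    simp at h
  | succ n ih =>
    have hpos : (0 : ℤ) < 3 ^ n := by positivity
    rw [pow_succ] at h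
    rw [rieszCoeff_succ, ih (by grind), ih (by grind), ih (by grind), add_zero, mul_zero, add_zero]

theorem rieszCoeff_of_le (h : 2 * |k| < 3 ^ n) (hnm : n ≤ m) :
    rieszCoeff a m k = rieszCoeff a n k := by
  induction m, hnm using Nat.le_induction with
  | base => rfl
  | succ m hnm ih =>
    have hk : 2 * |k| < 3 ^ m := h.trans_le (pow_le_pow_right₀ (by norm_num) hnm)
    rw [rieszCoeff_succ, rieszCoeff_eq_zero (k := k - 3 ^ m) (by grind),
      rieszCoeff_eq_zero (k := k + 3 ^ m) (by grind), add_zero, mul_zero, add_zero, ih]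

theorem rieszCoeff_succ_pow_add (h : 2 * |l| < 3 ^ n) :
    rieszCoeff a (n + 1) (3 ^ n + l) = a n / 2 * rieszCoeff a n l := by
  rw [rieszCoeff_succ, add_sub_cancel_left, rieszCoeff_eq_zero (k := 3 ^ n + l) (by grind),
    rieszCoeff_eq_zero (k := 3 ^ n + l + 3 ^ n) (by grind), zero_add, add_zero]

theorem abs_rieszCoeff_succ_pow (a : ℕ → ℝ) (n : ℕ) (k : ℤ) {p : ℕ} (hp : p ≠ 0) :
    |rieszCoeff a (n + 1) k| ^ p = |rieszCoeff a n k| ^ p +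
      |a n / 2| ^ p * (|rieszCoeff a n (k - 3 ^ n)| ^ p + |rieszCoeff a n (k + 3 ^ n)| ^ p) := by
  -- The coefficients vanish off `|k| < 3 ^ n / 2`, so at most one of the three terms is nonzero.
  have hpos : (0 : ℤ) < 3 ^ n := by positivity
  rw [rieszCoeff_succ]
  by_cases hk : 2 * |k| < 3 ^ n
  · rw [rieszCoeff_eq_zero (k := k - 3 ^ n) (by grind),
      rieszCoeff_eq_zero (k := k + 3 ^ n) (by grind)]
    simp [hp]
  · rw [rieszCoeff_eq_zero (not_lt.1 hk)]
    rcases le_total 0 k with h0 | h0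
    · rw [rieszCoeff_eq_zero (k := k + 3 ^ n) (by grind)]
      simp [hp, abs_mul, mul_pow]
    · rw [rieszCoeff_eq_zero (k := k - 3 ^ n) (by grind)]
      simp [hp, abs_mul, mul_pow]

theorem hasSum_abs_rieszCoeff_pow (a : ℕ → ℝ) (n : ℕ) {p : ℕ} (hp : p ≠ 0) :
    HasSum (fun k => |rieszCoeff a n k| ^ p) (∏ j ∈ Finset.range n, (1 + 2 * |a j / 2| ^ p)) := by
  induction n with
  | zero =>
    convert! hasSum_ite_eq (0 : ℤ) (1 : ℝ) using 2 with k
    rw [rieszCoeff_zero]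
    split_ifs <;> simp [hp]
  | succ n ih =>
    have hsub := (Equiv.subRight (3 ^ n : ℤ)).hasSum_iff.2 ih
    have hadd := (Equiv.addRight (3 ^ n : ℤ)).hasSum_iff.2 ih
    convert! ih.add ((hsub.add hadd).mul_left (|a n / 2| ^ p)) using 1
    · exact funext fun k => abs_rieszCoeff_succ_pow a n k hp
    · rw [Finset.prod_range_succ]
      ring

theorem continuous_rieszProd (a : ℕ → ℝ) (n : ℕ) : Continuous (rieszProd a n) := by
  unfold rieszProd
  fun_prop

theorem abs_re_fourier_le_one (k : ℤ) (x : UnitAddCircle) : |(fourier k x).re| ≤ 1 :=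
  (Complex.abs_re_le_norm _).trans (by rw [fourier_apply, Circle.norm_coe])

theorem rieszProd_nonneg (ha : ∀ j, |a j| ≤ 1) (n : ℕ) (x : UnitAddCircle) :
    0 ≤ rieszProd a n x := by
  refine Finset.prod_nonneg fun j _ => ?_
  have hle : |a j * (fourier (3 ^ j) x).re| ≤ 1 := by
    rw [abs_mul]
    exact mul_le_one₀ (ha j) (abs_nonneg _) (abs_re_fourier_le_one _ x)
  linarith [neg_le_of_abs_le hle]

theorem integrable_fourier_mul_rieszProd (a : ℕ → ℝ) (n : ℕ) (k : ℤ) :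
    Integrable (fun x => fourier k x * (rieszProd a n x : ℂ)) (haarAddCircle (T := 1)) :=
  ((fourier k).continuous.mul
    (Complex.continuous_ofReal.comp (continuous_rieszProd a n))).integrable_of_hasCompactSupport
      (.of_compactSpace _)

theorem integral_fourier (k : ℤ) :
    ∫ x, fourier k x ∂(haarAddCircle (T := 1)) = if k = 0 then 1 else 0 := by
  have h := congrFun (fourierCoeff_fourier (T := 1) 0) (-k)
  simpa [fourierCoeff, Pi.single_apply] using h

theorem integral_fourier_mul_rieszProd (a : ℕ → ℝ) (n : ℕ) (k : ℤ) :
    ∫ x, fourier k x * (rieszProd a n x : ℂ) ∂(haarAddCircle (T := 1)) = rieszCoeff a n k := by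
  induction n generalizing k with
  | zero =>
    simp only [rieszProd, Finset.range_zero, Finset.prod_empty, Complex.ofReal_one, mul_one,
      integral_fourier, rieszCoeff_zero]
    split_ifs <;> simp
  | succ n ih =>
    have hexpand : ∀ x : UnitAddCircle, fourier k x * (rieszProd a (n + 1) x : ℂ) =
        fourier k x * (rieszProd a n x : ℂ) + (a n / 2 : ℂ) *
          (fourier (k - 3 ^ n) x * (rieszProd a n x : ℂ) +
            fourier (k + 3 ^ n) x * (rieszProd a n x : ℂ)) := fun x => by
      rw [sub_eq_add_neg, fourier_add, fourier_add, fourier_neg, rieszProd,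
        Finset.prod_range_succ, ← rieszProd, Complex.ofReal_mul, Complex.ofReal_add,
        Complex.ofReal_mul, Complex.re_eq_add_conj, Complex.ofReal_one]
      ring
    have hint := integrable_fourier_mul_rieszProd a n
    have hint' : Integrable (fun x => (a n / 2 : ℂ) *
        (fourier (k - 3 ^ n) x * (rieszProd a n x : ℂ) +
          fourier (k + 3 ^ n) x * (rieszProd a n x : ℂ))) (haarAddCircle (T := 1)) :=
      ((hint _).add (hint _)).const_mul _
    rw [integral_congr_ae (.of_forall hexpand), integral_add (hint _) hint', integral_const_mul,
      integral_add (hint _) (hint _), ih, ih, ih, rieszCoeff_succ]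
    push_cast
    ring

/-- The measure `ρ` is the Riesz product `∏_j (1 + a_j cos (2π 3^j x))`, that is, the weak limit
of the partial products. Weak convergence is expressed by Fourier coefficients. -/
def IsRieszMeasure (a : ℕ → ℝ) (ρ : Measure UnitAddCircle) : Prop :=
  ∀ k, Tendsto (fun n => ∫ x, fourier k x * (rieszProd a n x : ℂ) ∂(haarAddCircle (T := 1))) atTop
    (𝓝 (∫ x, fourier k x ∂ρ))

theorem isRieszMeasure_haarAddCircle : IsRieszMeasure 0 haarAddCircle := fun k => by
  simp [rieszProd]

variable {ρ σ : Measure UnitAddCircle}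

theorem IsRieszMeasure.integral_fourier (hρ : IsRieszMeasure a ρ) (h : 2 * |k| < 3 ^ n) :
    ∫ x, fourier k x ∂ρ = rieszCoeff a n k := by
  refine tendsto_nhds_unique (hρ k) (tendsto_const_nhds.congr' ?_)
  filter_upwards [eventually_ge_atTop n] with m hm
  rw [integral_fourier_mul_rieszProd, rieszCoeff_of_le h hm]

theorem eventually_two_mul_abs_lt_three_pow (k : ℤ) : ∀ᶠ n in atTop, 2 * |k| < 3 ^ n :=
  (tendsto_pow_atTop_atTop_of_one_lt (by norm_num)).eventually_gt_atTop _

theorem IsRieszMeasure.integral_fourier_neg (hρ : IsRieszMeasure a ρ) (k : ℤ) :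
    ∫ x, fourier (-k) x ∂ρ = ∫ x, fourier k x ∂ρ := by
  obtain ⟨n, hn⟩ := (eventually_two_mul_abs_lt_three_pow k).exists
  rw [hρ.integral_fourier hn, hρ.integral_fourier (by rwa [abs_neg]), rieszCoeff_neg]

theorem IsRieszMeasure.integral_fourier_pow_add (hρ : IsRieszMeasure a ρ) (h : 2 * |l| < 3 ^ n) :
    ∫ x, fourier (3 ^ n + l) x ∂ρ = a n / 2 * ∫ x, fourier l x ∂ρ := by
  have hlt : 2 * |3 ^ n + l| < 3 ^ (n + 1) := by
    rw [pow_succ]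
    grind
  rw [hρ.integral_fourier hlt, hρ.integral_fourier h, rieszCoeff_succ_pow_add h]
  push_cast
  rfl

theorem IsRieszMeasure.integral_fourier_zero (hρ : IsRieszMeasure a ρ) :
    ∫ x, fourier 0 x ∂ρ = 1 := by
  rw [hρ.integral_fourier (n := 0) (by simp), rieszCoeff_zero, if_pos rfl, Complex.ofReal_one]

theorem IsRieszMeasure.isProbabilityMeasure (hρ : IsRieszMeasure a ρ) :
    IsProbabilityMeasure ρ := by
  have h := hρ.integral_fourier_zero
  simp only [fourier_zero, integral_const, Complex.real_smul, mul_one, Complex.ofReal_eq_one] at h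
  exact ⟨(ENNReal.toReal_eq_one_iff _).1 h⟩

theorem IsRieszMeasure.integral_fourier_pow_three (hρ : IsRieszMeasure a ρ) (n : ℕ) :
    ∫ x, fourier (3 ^ n) x ∂ρ = a n / 2 := by
  have h := hρ.integral_fourier_pow_add (n := n) (l := 0) (by simp)
  rwa [add_zero, hρ.integral_fourier_zero, mul_one] at h

theorem IsRieszMeasure.summable_norm_integral_fourier_pow (hρ : IsRieszMeasure a ρ) {p : ℕ}
    (hp : p ≠ 0) (ha : Summable fun j => |a j| ^ p) :
    Summable fun k : ℤ => ‖∫ x, fourier k x ∂ρ‖ ^ p := by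
  have ha' : Summable fun j => 2 * |a j / 2| ^ p := by
    simpa only [abs_div, div_pow] using (ha.div_const (|2| ^ p)).mul_left 2
  refine summable_of_sum_le (c := Real.exp (∑' j, 2 * |a j / 2| ^ p))
    (fun k => by positivity) fun F => ?_
  obtain ⟨n, hn⟩ := ((eventually_all_finset F).2 fun k _ =>
    eventually_two_mul_abs_lt_three_pow k).exists
  calc ∑ k ∈ F, ‖∫ x, fourier k x ∂ρ‖ ^ p = ∑ k ∈ F, |rieszCoeff a n k| ^ p :=
        Finset.sum_congr rfl fun k hk => by
          rw [hρ.integral_fourier (hn k hk), Complex.norm_real, Real.norm_eq_abs]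
    _ ≤ ∏ j ∈ Finset.range n, (1 + 2 * |a j / 2| ^ p) :=
        sum_le_hasSum F (fun k _ => by positivity) (hasSum_abs_rieszCoeff_pow a n hp)
    _ ≤ Real.exp (∑ j ∈ Finset.range n, 2 * |a j / 2| ^ p) :=
        Real.prod_one_add_le_exp_sum _ fun j => by positivity
    _ ≤ Real.exp (∑' j, 2 * |a j / 2| ^ p) :=
        Real.exp_le_exp.2 (ha'.sum_le_tsum _ fun j _ => by positivity)

theorem integral_fourier_withDensity_rieszProd (ha : ∀ j, |a j| ≤ 1) (n : ℕ) (k : ℤ) :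
    ∫ x, fourier k x ∂(haarAddCircle (T := 1)).withDensity
      (fun x => ENNReal.ofReal (rieszProd a n x)) =
      ∫ x, fourier k x * (rieszProd a n x : ℂ) ∂(haarAddCircle (T := 1)) := by
  rw [integral_withDensity_eq_integral_toReal_smul
    (continuous_rieszProd a n).measurable.ennreal_ofReal (by simp)]
  refine integral_congr_ae (.of_forall fun x => ?_)
  simp only [ENNReal.toReal_ofReal (rieszProd_nonneg ha n x), Complex.real_smul, mul_comm]

theorem isProbabilityMeasure_withDensity_rieszProd (ha : ∀ j, |a j| ≤ 1) (n : ℕ) :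
    IsProbabilityMeasure ((haarAddCircle (T := 1)).withDensity
      fun x => ENNReal.ofReal (rieszProd a n x)) := by
  have h := integral_fourier_withDensity_rieszProd ha n 0
  rw [integral_fourier_mul_rieszProd, rieszCoeff_of_le (n := 0) (by simp) n.zero_le,
    rieszCoeff_zero, if_pos rfl] at h
  simp only [fourier_zero, integral_const, Complex.real_smul, mul_one, Complex.ofReal_inj] at h
  exact ⟨(ENNReal.toReal_eq_one_iff _).1 h⟩

theorem tendsto_integral_fourier_mul_rieszProd (a : ℕ → ℝ) (k : ℤ) :
    ∃ c, Tendsto (fun n => ∫ x, fourier k x * (rieszProd a n x : ℂ) ∂(haarAddCircle (T := 1)))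
      atTop (𝓝 c) := by
  obtain ⟨n, hn⟩ := (eventually_two_mul_abs_lt_three_pow k).exists
  refine ⟨rieszCoeff a n k, tendsto_const_nhds.congr' ?_⟩
  filter_upwards [eventually_ge_atTop n] with m hm
  rw [integral_fourier_mul_rieszProd, rieszCoeff_of_le hn hm]

theorem exists_isRieszMeasure (ha : ∀ j, |a j| ≤ 1) : ∃ ρ, IsRieszMeasure a ρ := by
  let P : ℕ → ProbabilityMeasure UnitAddCircle := fun n =>
    ⟨_, isProbabilityMeasure_withDensity_rieszProd ha n⟩
  have hP : Tendsto P (hyperfilter ℕ) (𝓝 ((hyperfilter ℕ).map P).lim) :=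
    ((hyperfilter ℕ).map P).le_nhds_lim
  refine ⟨((hyperfilter ℕ).map P).lim, fun k => ?_⟩
  obtain ⟨c, hc⟩ := tendsto_integral_fourier_mul_rieszProd a k
  have hlim := (ProbabilityMeasure.tendsto_iff_forall_integral_rclike_tendsto ℂ).1 hP
    (BoundedContinuousFunction.mkOfCompact (fourier k))
  simp only [BoundedContinuousFunction.mkOfCompact_apply, P, ProbabilityMeasure.coe_mk,
    integral_fourier_withDensity_rieszProd ha] at hlim
  rwa [tendsto_nhds_unique hlim (hc.mono_left Nat.hyperfilter_le_atTop)]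

theorem integrable_fourier [IsFiniteMeasure ρ] (k : ℤ) : Integrable (fun x => fourier k x) ρ :=
  .of_bound (by fun_prop) 1 (.of_forall fun x => by rw [fourier_apply, Circle.norm_coe])

theorem memLp_re_fourier [IsFiniteMeasure ρ] (k : ℤ) (p : ℝ≥0∞) :
    MemLp (fun x => (fourier k x).re) p ρ :=
  .of_bound (by fun_prop) 1 (.of_forall (abs_re_fourier_le_one k))

theorem IsRieszMeasure.integral_re_fourier_pow_three (hρ : IsRieszMeasure a ρ) (n : ℕ) :
    ∫ x, (fourier (3 ^ n) x).re ∂ρ = a n / 2 := by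
  have := hρ.isProbabilityMeasure
  refine (integral_re (integrable_fourier _)).trans ?_
  rw [hρ.integral_fourier_pow_three]
  norm_num

theorem re_fourier_mul_re_fourier (k l : ℤ) (x : UnitAddCircle) :
    (fourier k x).re * (fourier l x).re =
      (fourier (k + l) x + fourier (k + -l) x).re / 2 := by
  rw [fourier_add, fourier_add, fourier_neg, Complex.add_re, Complex.mul_re, Complex.mul_re,
    Complex.conj_re, Complex.conj_im]
  ring

theorem IsRieszMeasure.covariance_re_fourier_pow_three (hρ : IsRieszMeasure a ρ) {i j : ℕ}
    (hij : i ≠ j) :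
    cov[fun x => (fourier (3 ^ i) x).re, fun x => (fourier (3 ^ j) x).re; ρ] = 0 := by
  have := hρ.isProbabilityMeasure
  wlog hji : j < i generalizing i j
  · rw [covariance_comm, this hij.symm (by lia)]
  have hlt : 2 * (3 : ℤ) ^ j < 3 ^ i :=
    calc 2 * (3 : ℤ) ^ j < 3 * 3 ^ j := mul_lt_mul_of_pos_right (by norm_num) (by positivity)
      _ = 3 ^ (j + 1) := (pow_succ' 3 j).symm
      _ ≤ 3 ^ i := pow_le_pow_right₀ (by norm_num) hji
  rw [covariance_eq_sub (memLp_re_fourier _ _) (memLp_re_fourier _ _),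
    hρ.integral_re_fourier_pow_three, hρ.integral_re_fourier_pow_three]
  have hprod : ∫ x, (fourier (3 ^ i) x).re * (fourier (3 ^ j) x).re ∂ρ =
      (∫ x, fourier (3 ^ i + 3 ^ j) x + fourier (3 ^ i + -3 ^ j) x ∂ρ).re / 2 := by
    simp_rw [re_fourier_mul_re_fourier]
    rw [integral_div]
    congr 1
    exact integral_re ((integrable_fourier _).add (integrable_fourier _))
  rw [integral_add (integrable_fourier _) (integrable_fourier _),
    hρ.integral_fourier_pow_add (by simpa), hρ.integral_fourier_pow_add (by simpa),
    hρ.integral_fourier_neg, hρ.integral_fourier_pow_three] at hprod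
  refine sub_eq_zero.2 (hprod.trans ?_)
  norm_cast
  ring

theorem variance_re_fourier_le_one [IsProbabilityMeasure ρ] (k : ℤ) :
    Var[fun x => (fourier k x).re; ρ] ≤ 1 :=
  (variance_le_sq_of_bounded (a := -1) (b := 1)
    (.of_forall fun x => abs_le.1 (abs_re_fourier_le_one k x)) (by fun_prop)).trans (by norm_num)

theorem IsRieszMeasure.not_absolutelyContinuous (hρ : IsRieszMeasure a ρ)
    (hσ : IsRieszMeasure b σ)
    (hab : Tendsto (fun n => ∑ j ∈ Finset.range n, (a j - b j) ^ 2) atTop atTop) : ¬ ρ ≪ σ := by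
  have := hρ.isProbabilityMeasure
  have := hσ.isProbabilityMeasure
  refine not_absolutelyContinuous_of_tendsto_sum_sq (X := fun j x => (fourier (3 ^ j) x).re)
    (fun _ => memLp_re_fourier _ _) (fun _ => memLp_re_fourier _ _)
    (fun _ _ => hρ.covariance_re_fourier_pow_three)
    (fun _ _ => hσ.covariance_re_fourier_pow_three)
    (fun _ => variance_re_fourier_le_one _) (fun _ => variance_re_fourier_le_one _) ?_
  simp only [hρ.integral_re_fourier_pow_three, hσ.integral_re_fourier_pow_three, ← sub_div,
    div_pow, ← Finset.sum_div]
  exact hab.atTop_div_const (by norm_num)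

theorem IsRieszMeasure.coeff_ofMeasure (hρ : IsRieszMeasure a ρ) (k : ℤ) :
    (MT.ofMeasure ρ).coeff k = ∫ x, fourier k x ∂ρ := by
  have := hρ.isProbabilityMeasure
  rw [MT.coeff_ofMeasure, hρ.integral_fourier_neg]

theorem IsRieszMeasure.ofMeasure_mem_rootsL1 (hρ : IsRieszMeasure a ρ)
    (ha : Summable fun j => |a j| ^ 4) : MT.ofMeasure ρ ∈ rootsL1 := by
  obtain ⟨f, hf⟩ := L1T.exists_coeff_eq_of_summable
    (c := fun k => (∫ x, fourier k x ∂ρ) ^ 2) <| by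
      simpa only [norm_pow, ← pow_mul] using hρ.summable_norm_integral_fourier_pow four_ne_zero ha
  refine ⟨2, one_le_two, f, MT.ext_coeff fun k => ?_⟩
  rw [hf, ← hρ.coeff_ofMeasure, sq, sq (MT.ofMeasure ρ)]
  exact (map_mul (MT.coeffHom k) _ _).symm

theorem absolutelyContinuous_of_toMT_eq_ofMeasure [IsFiniteMeasure ρ] {f : L1T}
    (hf : f.toMT = MT.ofMeasure ρ) : ρ ≪ haarAddCircle := by
  refine Measure.AbsolutelyContinuous.mk fun s hs h0 => ?_
  have h := (L1T.exists_toMT_eq_iff (MT.ofMeasure ρ)).1 ⟨f, hf⟩ s hs h0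
  rw [MT.ofMeasure_apply ρ hs, Complex.ofReal_eq_zero] at h
  exact (measureReal_eq_zero_iff).1 h

theorem idealL1_ne_top : idealL1.toSubmodule ≠ ⊤ := by
  let a : ℕ → ℝ := fun j => (√(j + 1))⁻¹
  have ha_sq : ∀ j, a j ^ 2 = 1 / (j + 1) := fun j => by
    rw [inv_pow, Real.sq_sqrt (by positivity), one_div]
  have ha_nonneg : ∀ j, 0 ≤ a j := fun j => by positivity
  have ha_le_one : ∀ j, |a j| ≤ 1 := fun j => by
    rw [← sq_le_one_iff_abs_le_one, ha_sq]
    exact div_le_one_of_le₀ (by simp) (by positivity)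
  have ha_summable : Summable fun j => |a j| ^ 4 := by
    refine ((summable_nat_add_iff 1).2 (Real.summable_one_div_nat_pow.2 one_lt_two)).congr
      fun j => ?_
    rw [abs_of_nonneg (ha_nonneg j), pow_mul (a j) 2 2, ha_sq, div_pow, one_pow, Nat.cast_succ]
  obtain ⟨ρ, hρ⟩ := exists_isRieszMeasure ha_le_one
  have := hρ.isProbabilityMeasure
  intro htop
  obtain ⟨f, hf⟩ : (⟨MT.ofMeasure ρ, subset_closure (hρ.ofMeasure_mem_rootsL1 ha_summable)⟩ : algA)
      ∈ idealL1.toSubmodule := htop ▸ Submodule.mem_top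
  refine hρ.not_absolutelyContinuous isRieszMeasure_haarAddCircle ?_
    (absolutelyContinuous_of_toMT_eq_ofMeasure hf)
  simpa only [Pi.zero_apply, sub_zero, ha_sq] using
    Real.tendsto_sum_range_one_div_nat_succ_atTop

end RieszProduct

end CircleAlg

end

theorem mainTheorem5 :
    CompleteSpace CircleAlg.algA ∧
    CircleAlg.IsGelfandSemisimple CircleAlg.algA ∧
    CircleAlg.IsGelfandSemisimple CircleAlg.L1T ∧
    (∃ (eA : ℤ ≃ₜ WeakDual.characterSpace ℂ CircleAlg.algA)
        (eB : ℤ ≃ₜ WeakDual.characterSpace ℂ CircleAlg.L1T),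
      (∀ (k : ℤ) (μ : CircleAlg.algA), eA k μ = CircleAlg.MT.coeff μ k) ∧
      (∀ (k : ℤ) (f : CircleAlg.L1T), eB k f = fourierCoeff f.fn k) ∧
      ∀ (n : ℕ) (k : Fin n → ℤ), Function.Injective k → ∀ a : Fin n → ℂ,
        CircleAlg.npNorm (fun i => eA (k i)) a = CircleAlg.npNorm (fun i => eB (k i)) a) ∧
    (¬ ∃ T : CircleAlg.algA →ₙₐ[ℂ] CircleAlg.L1T, Function.Bijective T) ∧
    (IsClosed (CircleAlg.idealL1.carrier) ∧ CircleAlg.idealL1.toSubmodule ≠ ⊤ ∧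
      CircleAlg.IsRadicalAlgebra CircleAlg.idealL1.Quotient) ∧
    (∀ I : CircleAlg.AlgIdeal CircleAlg.L1T, IsClosed I.carrier → I.toSubmodule ≠ ⊤ →
      ¬ CircleAlg.IsRadicalAlgebra I.Quotient) := by
  open CircleAlg in
  have hA := algA.eq_zero_of_comp_ofL1_eq_zero
  have hB : ∀ φ : L1T →ₙₐ[ℂ] ℂ, φ.comp L1T.intermediateAlgebra.ofL1 = 0 → φ = 0 := fun _ h => h
  exact ⟨inferInstance, algA.intermediateAlgebra.isGelfandSemisimple,
    L1T.intermediateAlgebra.isGelfandSemisimple,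
    ⟨algA.intermediateAlgebra.coeffHomeomorph hA, L1T.intermediateAlgebra.coeffHomeomorph hB,
      fun _ _ => rfl, fun k f => L1T.coeff_toMT f k,
      fun _ k _ a => (algA.intermediateAlgebra.npNorm_coeffChar k a).trans
        (L1T.intermediateAlgebra.npNorm_coeffChar k a).symm⟩,
    fun ⟨_, hT⟩ => idealL1_ne_top (idealL1_eq_top_of_bijective hT),
    ⟨isClosed_idealL1, idealL1_ne_top, isRadicalAlgebra_quotient_idealL1⟩,
    L1T.not_isRadicalAlgebra_quotient⟩
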